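/- Let $p$ be an odd prime with ring of $p$-adic integers $\mathbf{Z}_p$. For a prime power $v$ and $n \ge 1$, let $\operatorname{L}_n^*(\mathbf{F}_v)$ be the poset (under inclusion) of subspaces $U$ of $\mathbf{F}_v^n$ with $0 \ne U \ne \mathbf{F}_v^n$, on which $\mathrm{GL}_n(\mathbf{F}_v)$ acts. For $r \ge 1$ define the $r$th $p$-primary equivariant reduced Euler characteristic $$\widetilde{\chi}^p_r(n,v) = \frac{1}{|\mathrm{GL}_n(\mathbf{F}_v)|}\sum_{X \in \mathrm{Hom}(\mathbf{Z}\times\mathbf{Z}_p^{r-1},\,\mathrm{GL}_n(\mathbf{F}_v))} \widetilde{\chi}\big(C_{\operatorname{L}_n^*(\mathbf{F}_v)}(X(\mathbf{Z}\times\mathbf{Z}_p^{r-1}))\big),$$ where $C_{\operatorname{L}_n^*(\mathbf{F}_v)}(A)$ is the subposet of $A$-invariant subspaces and $\widetilde{\chi}$ is the reduced Euler characteristic of the order complex of a finite poset (so $\widetilde{\chi}(\emptyset) = -1$), and the $r$th $p$-primary generating function at $v$ $$F^p_r(x)(v) = 1 + \sum_{n \ge 1} \widetilde{\chi}^p_r(n,v)\,x^n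 .$$ Let $g$ be a prime number that is a primitive root modulo $p^2$, let $s,t \ge 1$ be natural numbers with $st = p-1$, and put $q = g^{p-1}$ and $u = g^s$. Then, for all $r \ge 1$ and $e \ge 0$, the identity of formal power series $$(1-x^t)\,\big(F^p_r(x)(u^{p^e})\big)^t = (1-x)^t\, F^p_r(x^t)(q^{p^e})$$ holds. -/

import Mathlib

open scoped PowerSeries

/-- The reduced Euler characteristic of (the order complex of) a finite poset `P`:
the sum of `(-1) ^ dim σ` over all simplices `σ`, that is over all chains of `P`, where a chain with
`c` elements has dimension `c - 1`; the empty chain (of dimension `-1`) is included.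
The empty poset has reduced Euler characteristic `-1`. -/
noncomputable def reducedEulerChar (P : Type*) [PartialOrder P] [Finite P] : ℤ :=
  ∑ᶠ σ : {σ : Finset P // IsChain (· ≤ ·) (σ : Set P)}, (-1) ^ (σ.1.card + 1)

/-- The group `ℤ × ℤ_p ^ (r - 1)`, written multiplicatively (used for `r ≥ 1`). -/
abbrev PrimaryGroup (p r : ℕ) [Fact p.Prime] : Type :=
  Multiplicative (ℤ × (Fin (r - 1) → ℤ_[p]))

section FiniteHom

variable {p : ℕ} [Fact p.Prime] {G : Type*} [Group G] [Finite G]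

/-- A homomorphism from `ℤ_p` to a finite group is determined by the image of `1`. In particular
all such homomorphisms are continuous. -/
theorem padicHom_ext (f h : Multiplicative ℤ_[p] →* G)
    (H : f (Multiplicative.ofAdd 1) = h (Multiplicative.ofAdd 1)) : f = h := by
  obtain ⟨v, m, hm, hN⟩ := Nat.exists_eq_pow_mul_and_not_dvd
    (Nat.card_pos (α := G)).ne' p (Fact.out : p.Prime).ne_one
  have hu : IsUnit ((m : ℤ_[p])) := by
    rw [PadicInt.isUnit_iff]
    have := (PadicInt.norm_int_lt_one_iff_dvd (p := p) (m : ℤ)).not.2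
      (by exact_mod_cast hm)
    exact le_antisymm (PadicInt.norm_le_one _) (not_lt.1 (by simpa using this))
  obtain ⟨w, hw⟩ := hu
  have key : ∀ φ : Multiplicative ℤ_[p] →* G, ∀ x : ℤ_[p],
      φ (Multiplicative.ofAdd x) = φ (Multiplicative.ofAdd 1) ^ (x.appr v) := by
    intro φ x
    obtain ⟨y, hy⟩ := Ideal.mem_span_singleton.1 (PadicInt.appr_spec v x)
    have hx : x = (x.appr v) • (1 : ℤ_[p]) + (Nat.card G) • ((↑w⁻¹ : ℤ_[p]) * y) := by
      have hw' : (m : ℤ_[p]) * (↑w⁻¹ : ℤ_[p]) = 1 := by rw [← hw]; simp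
      rw [hN]
      simp only [nsmul_eq_mul]
      push_cast
      linear_combination hy - (p : ℤ_[p]) ^ v * y * hw'
    conv_lhs => rw [hx]
    rw [ofAdd_add, ofAdd_nsmul, ofAdd_nsmul, map_mul, map_pow, map_pow, pow_card_eq_one', mul_one]
  refine MonoidHom.ext fun x => ?_
  exact (key f x.toAdd).trans ((congrArg (· ^ _) H).trans (key h x.toAdd).symm)

/-- The general linear group of a finite module is finite. -/
instance finite_generalLinearGroup (K V : Type*) [Field K] [AddCommGroup V] [Module K V]
    [Finite V] : Finite (LinearMap.GeneralLinearGroup K V) :=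
  haveI : Finite (Module.End K V) := DFunLike.finite _
  inferInstanceAs (Finite (Module.End K V)ˣ)

/-- There are only finitely many homomorphisms from `ℤ × ℤ_p ^ (r - 1)` to a finite group. -/
instance finite_primaryHom (r : ℕ) : Finite (PrimaryGroup p r →* G) := by
  classical
  let e : (PrimaryGroup p r →* G) → G × (Fin (r - 1) → G) := fun X =>
    (X (Multiplicative.ofAdd (1, 0)), fun i => X (Multiplicative.ofAdd (0, Pi.single i 1)))
  refine Finite.of_injective e fun X Y hXY => ?_
  have h1 : X (Multiplicative.ofAdd (1, 0)) = Y (Multiplicative.ofAdd (1, 0)) :=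
    congrArg Prod.fst hXY
  have h2 : ∀ i, X (Multiplicative.ofAdd (0, Pi.single i 1)) =
      Y (Multiplicative.ofAdd (0, Pi.single i 1)) := fun i => congrFun (congrArg Prod.snd hXY) i
  have hl : X.comp (AddMonoidHom.toMultiplicative (AddMonoidHom.inl ℤ (Fin (r - 1) → ℤ_[p]))) =
      Y.comp (AddMonoidHom.toMultiplicative (AddMonoidHom.inl ℤ (Fin (r - 1) → ℤ_[p]))) :=
    MonoidHom.ext_mint h1
  have hr : ∀ i, X.comp (AddMonoidHom.toMultiplicative ((AddMonoidHom.inr ℤ _).comp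
        (AddMonoidHom.single (fun _ : Fin (r - 1) => ℤ_[p]) i))) =
      Y.comp (AddMonoidHom.toMultiplicative ((AddMonoidHom.inr ℤ _).comp
        (AddMonoidHom.single (fun _ : Fin (r - 1) => ℤ_[p]) i))) := fun i =>
    padicHom_ext _ _ (h2 i)
  have hsub : MonoidHom.eqLocus X Y = ⊤ := by
    rw [eq_top_iff]
    rintro x -
    have hx : x = Multiplicative.ofAdd (x.toAdd.1, 0) *
        Multiplicative.ofAdd (∑ i, ((0 : ℤ), Pi.single i (x.toAdd.2 i))) := by
      rw [← ofAdd_add]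
      apply Multiplicative.toAdd.injective
      rw [toAdd_ofAdd]
      ext
      · simp [Prod.fst_sum]
      · simp [Prod.snd_sum, Finset.univ_sum_single]
    rw [hx]
    refine mul_mem (DFunLike.congr_fun hl (Multiplicative.ofAdd x.toAdd.1)) ?_
    rw [ofAdd_sum]
    exact prod_mem fun i _ => DFunLike.congr_fun (hr i) (Multiplicative.ofAdd (x.toAdd.2 i))
  refine MonoidHom.ext fun x => ?_
  have hx : x ∈ MonoidHom.eqLocus X Y := by rw [hsub]; exact Subgroup.mem_top x
  exact hx

end FiniteHom

section PrimaryEulerChar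

variable (p r : ℕ) [Fact p.Prime] (K : Type*) [Field K] [Finite K]

/-- The poset, ordered by inclusion, of those proper nontrivial subspaces `U` of `V`
(`0 ≠ U ≠ V`) that are invariant under the image of a homomorphism `X : A → GL(V)`. -/
abbrev InvariantSubspaces {K V A : Type*} [Field K] [AddCommGroup V] [Module K V] [Group A]
    (X : A →* LinearMap.GeneralLinearGroup K V) : Type _ :=
  {U : Submodule K V // U ≠ ⊥ ∧ U ≠ ⊤ ∧
    ∀ a : A, U.map ((X a : Module.End K V) : V →ₗ[K] V) = U}

/-- The `r`-th `p`-primary equivariant reduced Euler characteristic (`r ≥ 1`) of the `GL(V)`-poset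
of proper nontrivial subspaces of a finite vector space `V` over a finite field `K`:
`1 / |GL(V)|` times the sum, over all homomorphisms `X : ℤ × ℤ_p ^ (r - 1) → GL(V)`, of the
reduced Euler characteristic of the poset of `X`-invariant proper nontrivial subspaces.
The sum has finitely many terms by `finite_primaryHom`. -/
noncomputable def primaryEulerChar (V : Type*) [AddCommGroup V] [Module K V] [Finite V] : ℚ :=
  (∑ᶠ X : PrimaryGroup p r →* LinearMap.GeneralLinearGroup K V,
    (reducedEulerChar (InvariantSubspaces X) : ℚ)) / Nat.card (LinearMap.GeneralLinearGroup K V)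

/-- The `r`-th `p`-primary generating function at `q = |K|`: the power series
`1 + ∑_{n ≥ 1} χ(n) x ^ n` where `χ(n)` is the `r`-th `p`-primary equivariant reduced Euler
characteristic of the poset of proper nontrivial subspaces of `K ^ n`. -/
noncomputable def primaryGenFun : ℚ⟦X⟧ :=
  PowerSeries.mk fun n => if n = 0 then 1 else primaryEulerChar p r K (Fin n → K)

end PrimaryEulerChar

/-! For each coefficient, `ℤ_p ^ (r - 1)` may be replaced by the finite group `B = (ℤ/p^N) ^ (r -
1)` with `N` large (`coeff_primaryGenFun`). The theorem then follows from a product formula: the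
Euler series over `K` is `∏ (1 - X ^ d)`, with `d` running over the dimensions of the irreducible
`K`-representations of `B` (`eulerSeries_eq_prod`).

For the product formula, the reduced Euler characteristic of the invariant subspaces below `U` is
the Möbius function `μ(0, U)` of the lattice of invariant subspaces, so its sum over all invariant
`U` vanishes. Summing over all representations of `ℤ × B` and splitting each into a sub, a quotient
and a cocycle turns this into a convolution: the Euler series is inverse to the series of normalised
representation counts (`sum_eulerSum_mul_repCount`). The decisive point is that the number of
cocycles with values in `M` is always `|M|` (`natCard_oneCocycle`). By Burnside the normalised count
is the number of isomorphism classes of `B`-representations, and by Maschke its series is `∏ 1 / (1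
- X ^ d)`.

The dimensions are found from characters: those dividing `n` add up to `|Hom(B, F)|`, where `F` is
the extension of `K` of degree `n` (`sum_dim_dvd_eq_natCard_monoidHom`). As `g` is primitive modulo
`p ^ 2`, only the trivial character occurs when `t ∤ n`; when `n = t * m`, the degree `m` extension
of `L` gives the same field. These sums determine the multiset of dimensions, and
`eulerSeries_identity` reads off the identity. -/

/-! ### Reduced Euler characteristics of finite posets -/

theorem reducedEulerChar_eq_sum (P : Type*) [PartialOrder P] [Fintype P] [DecidableEq P]
    [DecidablePred fun σ : Finset P => IsChain (· ≤ ·) (σ : Set P)] :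
    reducedEulerChar P =
      ∑ σ ∈ Finset.univ.filter (fun σ : Finset P => IsChain (· ≤ ·) (σ : Set P)),
        (-1 : ℤ) ^ (σ.card + 1) := by
  classical
  rw [reducedEulerChar, finsum_eq_sum_of_fintype]
  exact (Finset.sum_subtype _ (by simp) (fun σ : Finset P => (-1 : ℤ) ^ (σ.card + 1))).symm

theorem reducedEulerChar_congr {P Q : Type*} [PartialOrder P] [PartialOrder Q] [Finite P]
    [Finite Q] (e : P ≃o Q) : reducedEulerChar P = reducedEulerChar Q := by
  classical
  have hchain : ∀ σ : Finset P, IsChain (· ≤ ·) (σ : Set P) ↔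
      IsChain (· ≤ ·) ((σ.map e.toEquiv.toEmbedding : Finset Q) : Set Q) := by
    intro σ
    simp only [IsChain, Set.Pairwise, Finset.coe_map, Set.mem_image, Finset.mem_coe]
    constructor
    · rintro h _ ⟨a, ha, rfl⟩ _ ⟨b, hb, rfl⟩ hab
      rcases h ha hb (fun h => hab (by rw [h])) with h | h
      · exact Or.inl (e.le_iff_le.2 h)
      · exact Or.inr (e.le_iff_le.2 h)
    · intro h a ha b hb hab
      rcases h ⟨a, ha, rfl⟩ ⟨b, hb, rfl⟩ (fun h => hab (e.injective h)) with h | h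
      · exact Or.inl (e.le_iff_le.1 h)
      · exact Or.inr (e.le_iff_le.1 h)
  refine finsum_eq_of_bijective (Equiv.subtypeEquiv (Equiv.finsetCongr e.toEquiv) hchain)
    (Equiv.bijective _) fun σ => ?_
  change _ = (-1 : ℤ) ^ ((σ.1.map e.toEquiv.toEmbedding).card + 1)
  rw [Finset.card_map]

/-- Decomposition of the nonempty chains of a finite poset by their largest element. -/
theorem reducedEulerChar_eq_neg_one_sub_sum (P : Type*) [PartialOrder P] [Fintype P] :
    reducedEulerChar P = -1 - ∑ a : P, reducedEulerChar {b : P // b < a} := by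
  classical
  let S := Finset.univ.filter (fun σ : Finset P => IsChain (· ≤ ·) (σ : Set P))
  let T : P → Finset (Finset P) := fun a =>
    S.filter fun σ => a ∈ σ ∧ ∀ b ∈ σ, b ≤ a
  have hT : ∀ a, ∑ σ ∈ T a, (-1 : ℤ) ^ (σ.card + 1) =
      - reducedEulerChar {b : P // b < a} := by
    intro a
    rw [reducedEulerChar_eq_sum, ← Finset.sum_neg_distrib]
    symm
    -- Adjoining `a` to a chain strictly below `a` gives each chain with largest element `a` exactly
    -- once and flips the sign.
    refine Finset.sum_bij
      (fun σ _ => insert a (σ.map (Function.Embedding.subtype _))) ?_ ?_ ?_ ?_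
    · intro σ hσ
      simp only [Finset.mem_filter, Finset.mem_univ, true_and, T, S] at hσ ⊢
      refine ⟨?_, Finset.mem_insert_self _ _, ?_⟩
      · rw [Finset.coe_insert, Finset.coe_map]
        refine IsChain.insert ?_ ?_
        · rintro _ ⟨x, hx, rfl⟩ _ ⟨y, hy, rfl⟩ hxy
          exact hσ hx hy (fun h => hxy (by rw [h]))
        · rintro _ ⟨x, hx, rfl⟩ _
          exact Or.inr x.2.le
      · intro b hb
        rcases Finset.mem_insert.1 hb with rfl | hb
        · exact le_rfl
        · obtain ⟨x, hx, rfl⟩ := Finset.mem_map.1 hb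
          exact x.2.le
    · intro σ _ τ _ h
      have ha : ∀ ρ : Finset {b : P // b < a}, a ∉ ρ.map (Function.Embedding.subtype _) := by
        intro ρ hρ
        obtain ⟨x, _, hx⟩ := Finset.mem_map.1 hρ
        exact x.2.ne hx
      have h2 := congrArg (fun s => Finset.erase s a) h
      simp only [Finset.erase_insert (ha _)] at h2
      exact Finset.map_injective _ h2
    · intro τ hτ
      simp only [Finset.mem_filter, Finset.mem_univ, true_and, T, S] at hτ
      obtain ⟨hc, ha, hle⟩ := hτ
      refine ⟨τ.subtype (· < a), ?_, ?_⟩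
      · simp only [Finset.mem_filter, Finset.mem_univ, true_and]
        intro x hx y hy hxy
        exact hc (Finset.mem_subtype.1 hx) (Finset.mem_subtype.1 hy)
          (fun h => hxy (Subtype.ext h))
      · ext x
        simp only [Finset.mem_insert, Finset.mem_map, Finset.mem_subtype,
          Function.Embedding.subtype_apply, Subtype.exists, exists_and_right, exists_eq_right]
        constructor
        · rintro (rfl | ⟨_, h⟩)
          · exact ha
          · exact h
        · intro hx
          by_cases hxa : x = a
          · exact Or.inl hxa
          · exact Or.inr ⟨lt_of_le_of_ne (hle x hx) hxa, hx⟩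
    · intro σ _
      rw [Finset.card_insert_of_notMem, Finset.card_map]
      · ring
      · intro hρ
        obtain ⟨x, _, hx⟩ := Finset.mem_map.1 hρ
        exact x.2.ne hx
  have hS : S = insert ∅ (Finset.univ.biUnion T) := by
    ext σ
    simp only [Finset.mem_insert, Finset.mem_biUnion, Finset.mem_univ, true_and, T,
      Finset.mem_filter]
    constructor
    · intro hσ
      rcases σ.eq_empty_or_nonempty with h | h
      · exact Or.inl h
      · obtain ⟨a, ha⟩ := σ.exists_maximal h
        refine Or.inr ⟨a, hσ, ha.1, fun b hb => ?_⟩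
        by_contra hba
        rcases (Finset.mem_filter.1 hσ).2.total hb ha.1 with h' | h'
        · exact hba h'
        · exact hba (ha.2 hb h')
    · rintro (rfl | ⟨a, h, _⟩)
      · simp [S]
      · exact h
  rw [reducedEulerChar_eq_sum]
  change ∑ σ ∈ S, (-1 : ℤ) ^ (σ.card + 1) = _
  rw [hS, Finset.sum_insert, Finset.sum_biUnion, Finset.sum_congr rfl fun a _ => hT a,
    Finset.sum_neg_distrib]
  · simp [sub_eq_add_neg]
  · intro a _ b _ hab
    rw [Function.onFun, Finset.disjoint_left]
    intro σ h1 h2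
    simp only [T, Finset.mem_filter] at h1 h2
    exact hab (le_antisymm (h2.2.2 a h1.2.1) (h1.2.2 b h2.2.1))
  · simp [T]

/-! ### Counting 1-cocycles of `ℤ × B` -/

section Cocycles

variable {K : Type*} [Field K] {M : Type*} [AddCommGroup M] [Module K M]

/-- The `1`-cocycles of a group with values in a representation. -/
abbrev OneCocycle {A : Type*} [Group A] (σ : Representation K A M) : Type _ :=
  {γ : A → M // ∀ a b, γ (a * b) = γ a + σ a (γ b)}

theorem OneCocycle.map_one {A : Type*} [Group A] {σ : Representation K A M} (γ : OneCocycle σ) :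
    γ.1 1 = 0 := by
  have := γ.2 1 1
  simpa using this

/-- The group `ℤ × B`, written multiplicatively. -/
abbrev IntProd (B : Type*) : Type _ := Multiplicative ℤ × B

variable {B : Type*} [Group B] (σ : Representation K (IntProd B) M)

/-- The generator of the factor `ℤ` of `ℤ × B`. -/
def intGen (B : Type*) [Group B] : IntProd B := (Multiplicative.ofAdd 1, 1)

theorem intGen_comm (b : B) : intGen B * ((1, b) : IntProd B) = (1, b) * intGen B := by
  simp [intGen]

/-- The zero set of a cocycle is a subgroup, and here it contains generators. -/
theorem oneCocycle_eq_zero (γ : OneCocycle σ) (hB : ∀ b : B, γ.1 (1, b) = 0)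
    (hz : γ.1 (intGen B) = 0) (a : IntProd B) : γ.1 a = 0 := by
  let S : Subgroup (IntProd B) :=
    { carrier := {a | γ.1 a = 0}
      one_mem' := γ.map_one
      mul_mem' := fun {a b} ha hb => by
        change γ.1 (a * b) = 0
        rw [γ.2, show γ.1 a = 0 from ha, show γ.1 b = 0 from hb, map_zero, add_zero]
      inv_mem' := fun {a} ha => by
        have h := γ.2 a⁻¹ a
        rw [inv_mul_cancel, γ.map_one, show γ.1 a = 0 from ha, map_zero, add_zero] at h
        exact h.symm }
  obtain ⟨k, b⟩ := a
  have : ((k, b) : IntProd B) = intGen B ^ (Multiplicative.toAdd k) * (1, b) := by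
    ext
    · change _ = Multiplicative.toAdd (((intGen B ^ (Multiplicative.toAdd k)) * ((1, b) : IntProd B)).1)
      simp [intGen]
    · simp [intGen]
  rw [this]
  exact S.mul_mem (S.zpow_mem hz _) (hB b)

/-- With `z` the generator of `ℤ`, the affine bijection `T m = z m + y` commutes with `B` because
`y` is fixed. Hence `T ^ k 0` is fixed by `B`, and `(k, b) ↦ T ^ k 0` is the cocycle. -/
theorem exists_oneCocycle_of_invariant (y : M) (hy : ∀ b : B, σ (1, b) y = y) :
    ∃ γ : OneCocycle σ, γ.1 (intGen B) = y ∧ ∀ b : B, γ.1 (1, b) = 0 := by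
  let T : Equiv.Perm M :=
    { toFun := fun m => σ (intGen B) m + y
      invFun := fun m => σ (intGen B)⁻¹ (m - y)
      left_inv := fun m => by simp
      right_inv := fun m => by simp }
  have hT : ∀ m, T m = σ (intGen B) m + y := fun m => rfl
  have hTs : ∀ m, T.symm m = σ (intGen B)⁻¹ (m - y) := fun m => rfl
  -- `T ^ k` is affine with linear part `z ^ k`; this becomes the cocycle identity.
  have key : ∀ k : ℤ, ∀ m : M, (T ^ k) m = σ (intGen B ^ k) m + (T ^ k) 0 := by
    intro k
    induction k using Int.induction_on with
    | zero => intro m; simp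
    | succ k ih =>
      intro m
      rw [zpow_add_one, zpow_add_one, Equiv.Perm.mul_apply, Equiv.Perm.mul_apply, ih, ih (T 0), hT,
        hT, map_add, map_add, map_mul, Module.End.mul_apply, map_zero (σ (intGen B)),
        map_zero (σ (intGen B ^ (k : ℤ))), zero_add, add_assoc]
    | pred k ih =>
      intro m
      rw [zpow_sub_one, zpow_sub_one, Equiv.Perm.mul_apply, Equiv.Perm.mul_apply, ih, ih (T⁻¹ 0),
        Equiv.Perm.inv_def, hTs, hTs, map_mul, Module.End.mul_apply]
      simp only [map_sub, map_zero]
      abel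
  have hcomm : ∀ b : B, ∀ m, σ (1, b) (T m) = T (σ (1, b) m) := by
    intro b m
    rw [hT, hT, map_add, hy, ← Module.End.mul_apply, ← map_mul, ← intGen_comm, map_mul,
      Module.End.mul_apply]
  have hinv : ∀ b : B, ∀ k : ℤ, σ (1, b) ((T ^ k) 0) = (T ^ k) 0 := by
    intro b k
    have hc' : ∀ m, σ (1, b) (T⁻¹ m) = T⁻¹ (σ (1, b) m) := by
      intro m
      rw [Equiv.Perm.eq_inv_iff_eq, ← hcomm, Equiv.Perm.inv_def, Equiv.apply_symm_apply]
    induction k using Int.induction_on with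
    | zero => simp
    | succ k ih =>
      rw [add_comm, zpow_add, zpow_one, Equiv.Perm.mul_apply, hcomm, ih]
    | pred k ih =>
      rw [sub_eq_neg_add, zpow_add, zpow_neg_one, Equiv.Perm.mul_apply, hc', ih]
  have hdec : ∀ a : IntProd B, a = intGen B ^ (Multiplicative.toAdd a.1) * (1, a.2) := by
    rintro ⟨k, b⟩
    ext
    · change _ = Multiplicative.toAdd (((intGen B ^ (Multiplicative.toAdd k)) * ((1, b) : IntProd B)).1)
      simp [intGen]
    · simp [intGen]
  refine ⟨⟨fun a => (T ^ (Multiplicative.toAdd a.1)) 0, fun a a' => ?_⟩, ?_, fun b => ?_⟩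
  · beta_reduce
    rw [Prod.fst_mul, toAdd_mul, zpow_add, Equiv.Perm.mul_apply, key, add_comm]
    congr 1
    conv_rhs => rw [hdec a, map_mul, Module.End.mul_apply, hinv]
  · simp [intGen, hT]
  · simp

variable [Finite B]

/-- For a finite group `B` of order invertible in `K`, the number of `1`-cocycles of `ℤ × B` with
values in a finite representation `M` is the number of elements of `M`. -/
theorem natCard_oneCocycle (hB : (Nat.card B : K) ≠ 0) :
    Nat.card (OneCocycle σ) = Nat.card M := by
  classical
  have := Fintype.ofFinite B
  let c : K := (Nat.card B : K)⁻¹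
  let avg : (B → M) → M := fun f => c • ∑ b, f b
  have avg_const : ∀ m, avg (fun _ => m) = m := by
    intro m
    simp only [avg, c, Finset.sum_const, Finset.card_univ, ← Nat.card_eq_fintype_card,
      ← Nat.cast_smul_eq_nsmul K, smul_smul, inv_mul_cancel₀ hB, one_smul]
  have avg_add : ∀ f g : B → M, avg (fun b => f b + g b) = avg f + avg g := by
    intro f g
    simp only [avg, Finset.sum_add_distrib, smul_add]
  have avg_map : ∀ (φ : M →ₗ[K] M) (f : B → M), avg (fun b => φ (f b)) = φ (avg f) := by
    intro φ f
    simp only [avg, map_smul, map_sum]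
  have avg_mul_left : ∀ (b : B) (f : B → M), avg (fun x => f (b * x)) = avg f := by
    intro b f
    simp only [avg]
    exact congrArg _ (Equiv.sum_comp (Equiv.mulLeft b) f)
  have avg_inv : ∀ (m : M) (b : B), σ (1, b) (avg fun x => σ (1, x) m) = avg fun x => σ (1, x) m := by
    intro m b
    rw [← avg_map, ← avg_mul_left b fun x => σ (1, x) m]
    congr 1
    funext x
    rw [← Module.End.mul_apply, ← map_mul]
    simp
  -- The bijection averages `γ (z b)` over `b`. If the average is `0`, averaging `γ (z b' b) = γ b'
  -- + b' γ (z b)` over `b` gives `γ b' = 0`, and then `γ (z b) = γ z` forces `γ z = 0`.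
  refine Nat.card_eq_of_bijective
    (fun γ : OneCocycle σ => avg fun b => γ.1 (intGen B * (1, b))) ⟨?_, ?_⟩
  · have h0 : ∀ γ : OneCocycle σ, (avg fun b => γ.1 (intGen B * (1, b))) = 0 → ∀ a, γ.1 a = 0 := by
      intro γ h
      have h1 : ∀ b' : B, γ.1 (1, b') = 0 := by
        intro b'
        have e1 : (avg fun b => γ.1 (intGen B * (1, b' * b))) = 0 := by
          rw [avg_mul_left b' fun b => γ.1 (intGen B * (1, b)), h]
        have e2 : (fun b => γ.1 (intGen B * (1, b' * b))) =
            fun b => γ.1 (1, b') + σ (1, b') (γ.1 (intGen B * (1, b))) := by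
          funext b
          rw [← γ.2, ← mul_assoc, ← intGen_comm, mul_assoc]
          simp
        rw [e2, avg_add, avg_const, avg_map, h, map_zero, add_zero] at e1
        exact e1
      refine oneCocycle_eq_zero σ γ h1 ?_
      have e2 : (fun b => γ.1 (intGen B * (1, b))) = fun b => γ.1 (intGen B) := by
        funext b
        rw [γ.2, h1, map_zero, add_zero]
      rw [e2, avg_const] at h
      exact h
    intro γ γ' h
    let δ : OneCocycle σ := ⟨fun a => γ.1 a + (-1 : M →ₗ[K] M) (γ'.1 a), fun a b => by
      beta_reduce
      rw [γ.2, γ'.2]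
      simp only [map_add, LinearMap.neg_apply, Module.End.one_apply, map_neg]
      abel⟩
    have hδ := h0 δ (by
      change avg (fun b => γ.1 (intGen B * (1, b)) + (-1 : M →ₗ[K] M) (γ'.1 (intGen B * (1, b)))) = 0
      rw [avg_add, avg_map]
      simp only at h
      rw [h]
      simp)
    refine Subtype.ext (funext fun a => ?_)
    have := hδ a
    simpa [δ, ← sub_eq_add_neg, sub_eq_zero] using this
  · intro x
    let y : M := avg fun b => σ (1, b) x
    have hy : ∀ b : B, σ (1, b) y = y := avg_inv x
    obtain ⟨γ, hz, h1⟩ := exists_oneCocycle_of_invariant σ y hy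
    -- A coboundary plus the cocycle attached to the invariant part `y` of `x`. Its value at `z b`
    -- is `x - z (b x - y)`, and `b x - y` averages to `0`.
    let δ : OneCocycle σ := ⟨fun a => (x - y) - σ a (x - y) + γ.1 a, fun a b => by
      beta_reduce
      rw [γ.2, map_mul, Module.End.mul_apply]
      simp only [map_add, map_sub]
      abel⟩
    refine ⟨δ, ?_⟩
    have e : (fun b => δ.1 (intGen B * (1, b))) =
        fun b => x + ((-σ (intGen B)) (σ (1, b) x + (- y))) := by
      funext b
      change (x - y) - σ (intGen B * (1, b)) (x - y) + γ.1 (intGen B * (1, b)) = _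
      rw [γ.2, h1, hz, map_mul, Module.End.mul_apply, map_sub (σ (1, b)), hy]
      simp only [map_add, map_sub, map_zero, LinearMap.neg_apply, map_neg]
      abel
    change avg (fun b => δ.1 (intGen B * (1, b))) = x
    rw [e, avg_add, avg_const, avg_map, avg_add, avg_const]
    change x + (-σ (intGen B)) (y + -y) = x
    simp

end Cocycles

/-! ### The Möbius function of the lattice of invariant subspaces -/

section Weights

variable {K V A : Type*} [Field K] [AddCommGroup V] [Module K V] [Group A]

/-- The subspace `U` is invariant under the representation `ρ`. -/
abbrev IsInvariantSubspace (ρ : Representation K A V) (U : Submodule K V) : Prop :=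
  ∀ a, U.map (ρ a) = U

theorem isInvariantSubspace_of_le {ρ : Representation K A V} {U : Submodule K V}
    (h : ∀ a, U.map (ρ a) ≤ U) : IsInvariantSubspace ρ U := by
  refine fun a => le_antisymm (h a) fun u hu => ?_
  exact ⟨ρ a⁻¹ u, h a⁻¹ ⟨u, hu, rfl⟩, by simp⟩

/-- The reduced Euler characteristic of the poset of nonzero invariant subspaces strictly
contained in `U`; by convention it is `1` for `U = 0`. -/
noncomputable def lowerEulerChar [Finite V] (ρ : Representation K A V) (U : Submodule K V) : ℤ :=
  open Classical in
  if U = ⊥ then 1 else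
    reducedEulerChar {S : Submodule K V // S ≠ ⊥ ∧ S < U ∧ IsInvariantSubspace ρ S}

/-- The terms at `⊥` and `⊤` are `1` and the reduced Euler characteristic of the proper part.
Splitting the chains of the proper part by largest element shows that the latter is `-1` minus the
remaining terms. -/
theorem sum_lowerEulerChar_eq_zero [Finite V] [Nontrivial V] (ρ : Representation K A V)
    [Fintype (Submodule K V)] [DecidablePred (IsInvariantSubspace ρ)] :
    ∑ U ∈ Finset.univ.filter (IsInvariantSubspace ρ), lowerEulerChar ρ U = 0 := by
  classical
  let Q := {S : Submodule K V // S ≠ ⊥ ∧ S < ⊤ ∧ IsInvariantSubspace ρ S}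
  have hins : Finset.univ.filter (IsInvariantSubspace ρ) = insert ⊥ (insert ⊤
      (Finset.univ.filter fun S => S ≠ ⊥ ∧ S < ⊤ ∧ IsInvariantSubspace ρ S)) := by
    ext S
    simp only [Finset.mem_filter, Finset.mem_univ, true_and, Finset.mem_insert]
    constructor
    · intro h
      by_cases h1 : S = ⊥
      · exact Or.inl h1
      by_cases h2 : S = ⊤
      · exact Or.inr (Or.inl h2)
      exact Or.inr (Or.inr ⟨h1, lt_top_iff_ne_top.2 h2, h⟩)
    · rintro (rfl | rfl | h)
      · exact fun a => Submodule.map_bot _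
      · exact isInvariantSubspace_of_le fun a => le_top
      · exact h.2.2
  have hQ : ∀ a : Q, lowerEulerChar ρ a.1 = reducedEulerChar {b : Q // b < a} := by
    intro a
    rw [lowerEulerChar, if_neg a.2.1]
    refine reducedEulerChar_congr
      { toFun := fun S => ⟨⟨S.1, S.2.1, S.2.2.1.trans a.2.2.1, S.2.2.2⟩, S.2.2.1⟩
        invFun := fun S => ⟨S.1.1, S.1.2.1, S.2, S.1.2.2.2⟩
        left_inv := fun S => rfl
        right_inv := fun S => rfl
        map_rel_iff' := Iff.rfl }
  rw [hins, Finset.sum_insert, Finset.sum_insert,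
    Finset.sum_subtype (p := fun S => S ≠ ⊥ ∧ S < ⊤ ∧ IsInvariantSubspace ρ S) _
      (by simp) (lowerEulerChar ρ), Finset.sum_congr rfl fun a _ => hQ a]
  · rw [lowerEulerChar, if_pos rfl, lowerEulerChar, if_neg top_ne_bot,
      reducedEulerChar_eq_neg_one_sub_sum]
    ring
  · simp
  · simp [bot_ne_top]

theorem lowerEulerChar_map {V' : Type*} [AddCommGroup V'] [Module K V'] [Finite V] [Finite V']
    (ρ : Representation K A V) (ρ' : Representation K A V') (i : V →ₗ[K] V')
    (hi : Function.Injective i) (hρ : ∀ a v, i (ρ a v) = ρ' a (i v)) (U : Submodule K V) :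
    lowerEulerChar ρ' (U.map i) = lowerEulerChar ρ U := by
  have hbot : ∀ S : Submodule K V, S.map i = ⊥ ↔ S = ⊥ := fun S => by
    rw [← Submodule.map_bot i, (Submodule.map_injective_of_injective hi).eq_iff]
  have hinv : ∀ S : Submodule K V, IsInvariantSubspace ρ' (S.map i) ↔ IsInvariantSubspace ρ S := by
    intro S
    refine forall_congr' fun a => ?_
    rw [← (Submodule.map_injective_of_injective hi).eq_iff, ← Submodule.map_comp,
      ← Submodule.map_comp, show ρ' a ∘ₗ i = i ∘ₗ ρ a from LinearMap.ext fun v => (hρ a v).symm]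
  by_cases hU : U = ⊥
  · rw [lowerEulerChar, lowerEulerChar, if_pos hU, if_pos ((hbot U).2 hU)]
  rw [lowerEulerChar, lowerEulerChar, if_neg hU, if_neg (mt (hbot U).1 hU)]
  have hle : ∀ {S T : Submodule K V}, S.map i ≤ T.map i ↔ S ≤ T := fun {S T} =>
    Submodule.map_le_map_iff_of_injective hi _ _
  have hlt : ∀ {S T : Submodule K V}, S.map i < T.map i ↔ S < T := fun {S T} => by
    rw [lt_iff_le_not_ge, lt_iff_le_not_ge, hle, hle]
  have hmap : ∀ S : Submodule K V', S < U.map i → (S.comap i).map i = S := fun S hS =>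
    Submodule.map_comap_eq_of_le (hS.le.trans (LinearMap.map_le_range))
  have hcomap : ∀ S : Submodule K V', S ≠ ⊥ ∧ S < U.map i ∧ IsInvariantSubspace ρ' S →
      S.comap i ≠ ⊥ ∧ S.comap i < U ∧ IsInvariantSubspace ρ (S.comap i) := by
    intro S hS
    rw [← hlt, ← hinv, hmap _ hS.2.1]
    exact ⟨fun h => hS.1 (by rw [← hmap S hS.2.1, h, Submodule.map_bot]), hS.2⟩
  exact (reducedEulerChar_congr
    { toFun := fun S => ⟨S.1.map i, mt (hbot _).1 S.2.1, hlt.2 S.2.2.1, (hinv _).2 S.2.2.2⟩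
      invFun := fun S => ⟨S.1.comap i, hcomap S.1 S.2⟩
      left_inv := fun S => Subtype.ext (Submodule.comap_map_eq_of_injective hi _)
      right_inv := fun S => Subtype.ext (hmap S.1 S.2.2.1)
      map_rel_iff' := hle }).symm

end Weights

/-! ### Block triangular representations -/

section Blocks

variable {K U W V A : Type*} [Field K] [AddCommGroup U] [Module K U] [AddCommGroup W] [Module K W]
  [AddCommGroup V] [Module K V] [Group A]

/-- The representation on `U × W` with diagonal blocks `Y` and `Z` defined by a cocycle. -/
def blockRep (Y : Representation K A U) (Z : Representation K A W)
    (γ : OneCocycle (Representation.linHom Z Y)) : Representation K A (U × W) where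
  -- The off-diagonal block is `γ a ∘ Z a`: with this twist, multiplicativity is exactly the cocycle
  -- condition for `linHom Z Y`.
  toFun a := LinearMap.prod (Y a ∘ₗ LinearMap.fst K U W + γ.1 a ∘ₗ Z a ∘ₗ LinearMap.snd K U W)
    (Z a ∘ₗ LinearMap.snd K U W)
  map_one' := by
    rw [γ.map_one]
    ext <;> simp
  map_mul' a b := by
    rw [γ.2]
    refine LinearMap.ext fun x => Prod.ext ?_ ?_
    · simp [add_assoc]
      abel
    · simp

/-- Transport of a representation along a linear equivalence. -/
def conjRep (φ : V ≃ₗ[K] W) (ρ : Representation K A V) : Representation K A W :=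
  (φ.conjRingEquiv : Module.End K V →* Module.End K W).comp ρ

@[simp]
theorem conjRep_apply (φ : V ≃ₗ[K] W) (ρ : Representation K A V) (a : A) (w : W) :
    conjRep φ ρ a w = φ (ρ a (φ.symm w)) :=
  rfl

theorem blockRep_injective :
    Function.Injective fun x : (Σ Y : Representation K A U, Σ Z : Representation K A W,
      OneCocycle (Representation.linHom Z Y)) => blockRep x.1 x.2.1 x.2.2 := by
  rintro ⟨Y, Z, γ⟩ ⟨Y', Z', γ'⟩ h
  have h1 : ∀ a x, blockRep Y Z γ a x = blockRep Y' Z' γ' a x := fun a x => by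
    simp only at h
    rw [h]
  obtain rfl : Y = Y' := by
    refine MonoidHom.ext fun a => LinearMap.ext fun u => ?_
    simpa [blockRep] using congrArg Prod.fst (h1 a (u, 0))
  obtain rfl : Z = Z' := by
    refine MonoidHom.ext fun a => LinearMap.ext fun w => ?_
    simpa [blockRep] using congrArg Prod.snd (h1 a (0, w))
  obtain rfl : γ = γ' := by
    refine Subtype.ext (funext fun a => LinearMap.ext fun w => ?_)
    simpa [blockRep] using congrArg Prod.fst (h1 a (0, Z a⁻¹ w))
  rfl

theorem exists_blockRep_eq (P : Representation K A (U × W)) (hP : ∀ a u, (P a (u, 0)).2 = 0) :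
    ∃ (Y : Representation K A U) (Z : Representation K A W)
      (γ : OneCocycle (Representation.linHom Z Y)), blockRep Y Z γ = P := by
  have hinl : ∀ a u, P a (u, 0) = ((P a (u, 0)).1, 0) := fun a u => Prod.ext rfl (hP a u)
  have hsplit : ∀ a u w, P a (u, w) = P a (u, 0) + P a (0, w) := fun a u w => by
    rw [← map_add]
    simp
  have hsnd : ∀ a x, (P a x).2 = (P a (0, x.2)).2 := fun a x => by
    rw [show x = (x.1, x.2) from rfl, hsplit, Prod.snd_add, hP, zero_add]
  have hmul : ∀ a b x, P (a * b) x = P a (P b x) := fun a b x => by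
    rw [map_mul, Module.End.mul_apply]
  let Y : Representation K A U :=
    { toFun := fun a => LinearMap.fst K U W ∘ₗ P a ∘ₗ LinearMap.inl K U W
      map_one' := by
        ext
        simp
      map_mul' := fun a b => by
        refine LinearMap.ext fun u => ?_
        change (P (a * b) (u, 0)).1 = (P a ((P b (u, 0)).1, 0)).1
        rw [← hinl, hmul] }
  let Z : Representation K A W :=
    { toFun := fun a => LinearMap.snd K U W ∘ₗ P a ∘ₗ LinearMap.inr K U W
      map_one' := by
        ext
        simp
      map_mul' := fun a b => by
        refine LinearMap.ext fun w => ?_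
        change (P (a * b) (0, w)).2 = (P a (0, (P b (0, w)).2)).2
        rw [← hsnd, hmul] }
  have hY : ∀ a u, Y a u = (P a (u, 0)).1 := fun a u => rfl
  have hZ : ∀ a w, Z a w = (P a (0, w)).2 := fun a w => rfl
  let γ : OneCocycle (Representation.linHom Z Y) :=
    ⟨fun a => (LinearMap.fst K U W ∘ₗ P a ∘ₗ LinearMap.inr K U W) ∘ₗ Z a⁻¹, fun a b => by
      refine LinearMap.ext fun w => ?_
      change (P (a * b) (0, Z (a * b)⁻¹ w)).1 =
        (P a (0, Z a⁻¹ w)).1 + Y a (P b (0, Z b⁻¹ (Z a⁻¹ w))).1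
      have e : Z (a * b)⁻¹ w = Z b⁻¹ (Z a⁻¹ w) := by
        rw [mul_inv_rev, map_mul, Module.End.mul_apply]
      have e2 : (P b (0, Z b⁻¹ (Z a⁻¹ w))).2 = Z a⁻¹ w := by
        rw [← hZ]
        simp
      have e3 := hsplit a (P b (0, Z b⁻¹ (Z a⁻¹ w))).1 (P b (0, Z b⁻¹ (Z a⁻¹ w))).2
      rw [Prod.mk.eta, e2] at e3
      rw [e, hmul, hY, add_comm, ← Prod.fst_add, e3]⟩
  refine ⟨Y, Z, γ, MonoidHom.ext fun a => LinearMap.ext fun x => Prod.ext ?_ ?_⟩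
  · change (P a (x.1, 0)).1 + (P a (0, Z a⁻¹ (Z a x.2))).1 = _
    rw [Representation.inv_self_apply, ← Prod.fst_add, ← hsplit]
  · exact (hsnd a x).symm

/-- The image of `U` under a linear equivalence `U × W ≃ V`. -/
def leftRange (φ : (U × W) ≃ₗ[K] V) : Submodule K V :=
  LinearMap.range (φ.toLinearMap ∘ₗ LinearMap.inl K U W)

theorem mem_leftRange (φ : (U × W) ≃ₗ[K] V) (v : V) :
    v ∈ leftRange φ ↔ (φ.symm v).2 = 0 := by
  constructor
  · rintro ⟨u, rfl⟩
    simp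
  · intro h
    refine ⟨(φ.symm v).1, ?_⟩
    change φ ((φ.symm v).1, 0) = v
    rw [← h, Prod.mk.eta, LinearEquiv.apply_symm_apply]

/-- Representations on `V ≃ U × W` for which `U` is invariant are described by their diagonal
blocks together with a cocycle with values in `Hom(W, U)`. -/
noncomputable def invariantRepEquiv (φ : (U × W) ≃ₗ[K] V) :
    (Σ Y : Representation K A U, Σ Z : Representation K A W,
      OneCocycle (Representation.linHom Z Y)) ≃
    {X : Representation K A V // IsInvariantSubspace X (leftRange φ)} :=
  Equiv.ofBijective (fun x => ⟨conjRep φ (blockRep x.1 x.2.1 x.2.2), by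
    refine isInvariantSubspace_of_le fun a => ?_
    rintro _ ⟨_, ⟨u, rfl⟩, rfl⟩
    exact ⟨x.1 a u, by simp [blockRep]⟩⟩) <| by
  constructor
  · intro x y h
    refine blockRep_injective (MonoidHom.ext fun a => LinearMap.ext fun v => φ.injective ?_)
    have := congrArg (fun X => X.1 a (φ v)) h
    simpa using this
  · rintro ⟨X, hX⟩
    obtain ⟨Y, Z, γ, h⟩ := exists_blockRep_eq (conjRep φ.symm X) fun a u => by
      change (φ.symm (X a (φ (u, 0)))).2 = 0
      rw [← mem_leftRange, ← hX a]
      exact ⟨_, ⟨u, rfl⟩, rfl⟩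
    refine ⟨⟨Y, Z, γ⟩, Subtype.ext (MonoidHom.ext fun a => LinearMap.ext fun v => ?_)⟩
    simp [h]

/-- The weight sees only the block on `U`, so the quotient block and the cocycle can be summed out
freely. -/
theorem lowerEulerChar_invariantRepEquiv [Finite U] [Finite W] [Finite V] (φ : (U × W) ≃ₗ[K] V)
    (x : Σ Y : Representation K A U, Σ Z : Representation K A W,
      OneCocycle (Representation.linHom Z Y)) :
    lowerEulerChar (invariantRepEquiv φ x).1 (leftRange φ) = lowerEulerChar x.1 ⊤ := by
  rw [← lowerEulerChar_map x.1 (invariantRepEquiv φ x).1 (φ.toLinearMap ∘ₗ LinearMap.inl K U W)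
    (φ.injective.comp LinearMap.inl_injective) (fun a u => by simp [invariantRepEquiv, blockRep]),
    ← LinearMap.range_eq_map]
  rfl

end Blocks

/-! ### Representations of `ℤ × B` as commuting pairs -/

section IntProdRep

variable {K V B : Type*} [Field K] [AddCommGroup V] [Module K V] [Group B]

theorem zpow_apply_comm (g : V ≃ₗ[K] V) (f : V →ₗ[K] V) (h : ∀ v, g (f v) = f (g v)) (k : ℤ)
    (v : V) : (g ^ k) (f v) = f ((g ^ k) v) := by
  let S : Subgroup (V ≃ₗ[K] V) :=
    { carrier := {g | ∀ v, g (f v) = f (g v)}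
      one_mem' := fun v => rfl
      mul_mem' := fun {a b} ha hb v => by
        change a (b (f v)) = f (a (b v))
        rw [hb, ha]
      inv_mem' := fun {a} ha v => by
        apply a.injective
        change a (a.symm (f v)) = a (f (a.symm v))
        rw [ha, a.apply_symm_apply, a.apply_symm_apply] }
  exact (S.zpow_mem (show g ∈ S from h) k) v

/-- The representation of `ℤ × B` given by a representation of `B` and a commuting
automorphism. -/
noncomputable def intProdRep (g : V ≃ₗ[K] V) (ρ : Representation K B V)
    (h : ∀ b v, g (ρ b v) = ρ b (g v)) : Representation K (IntProd B) V where
  toFun a := (g ^ (Multiplicative.toAdd a.1)).toLinearMap ∘ₗ ρ a.2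
  map_one' := by
    ext
    simp
  map_mul' a b := by
    refine LinearMap.ext fun v => ?_
    change (g ^ (Multiplicative.toAdd a.1 + Multiplicative.toAdd b.1)) (ρ (a.2 * b.2) v) =
      (g ^ (Multiplicative.toAdd a.1)) (ρ a.2 ((g ^ (Multiplicative.toAdd b.1)) (ρ b.2 v)))
    rw [← zpow_apply_comm g (ρ a.2) (h a.2), zpow_add, map_mul]
    rfl

theorem intProdRep_apply (g : V ≃ₗ[K] V) (ρ : Representation K B V)
    (h : ∀ b v, g (ρ b v) = ρ b (g v)) (a : IntProd B) (v : V) :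
    intProdRep g ρ h a v = (g ^ (Multiplicative.toAdd a.1)) (ρ a.2 v) :=
  rfl

/-- A representation of `ℤ × B` is a representation of `B` with a commuting automorphism. -/
noncomputable def repIntProdEquiv :
    Representation K (IntProd B) V ≃
      Σ g : V ≃ₗ[K] V, {ρ : Representation K B V // ∀ b v, g (ρ b v) = ρ b (g v)} where
  toFun X := ⟨LinearEquiv.ofLinearMap (X (intGen B)) (X (intGen B)⁻¹)
      (LinearMap.ext fun v => by simp) (LinearMap.ext fun v => by simp),
    X.comp (MonoidHom.inr _ _), fun b v => by
      change X _ (X (1, b) v) = X (1, b) (X _ v)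
      rw [← Module.End.mul_apply, ← map_mul, intGen_comm, map_mul, Module.End.mul_apply]⟩
  invFun x := intProdRep x.1 x.2.1 x.2.2
  left_inv X := by
    refine MonoidHom.ext fun a => ?_
    have h1 : (LinearEquiv.automorphismGroup.toLinearMapMonoidHom).comp (zpowersHom (V ≃ₗ[K] V)
        (LinearEquiv.ofLinearMap (X (intGen B)) (X (intGen B)⁻¹)
        (LinearMap.ext fun v => by simp) (LinearMap.ext fun v => by simp))) =
        X.comp (MonoidHom.inl (Multiplicative ℤ) B) := by
      refine MonoidHom.ext_mint (LinearMap.ext fun v => ?_)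
      simp [intGen]
    have h2 : X a = X (a.1, 1) * X (1, a.2) := by
      rw [← map_mul]
      simp
    rw [h2]
    exact congrArg (· * X (1, a.2)) (DFunLike.congr_fun h1 a.1)
  right_inv x := by
    obtain ⟨g, ρ, h⟩ := x
    refine Sigma.subtype_ext ?_ ?_
    · refine LinearEquiv.ext fun v => ?_
      change intProdRep g ρ h (intGen B) v = g v
      simp [intProdRep_apply, intGen]
    · refine MonoidHom.ext fun b => LinearMap.ext fun v => ?_
      change intProdRep g ρ h (1, b) v = ρ b v
      simp [intProdRep_apply]

instance [Finite V] : Finite (V ≃ₗ[K] V) := DFunLike.finite _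

instance finite_representation [Finite V] [Finite B] : Finite (Representation K B V) :=
  have : Finite (Module.End K V) := DFunLike.finite _
  DFunLike.finite _

instance finite_representation_intProd [Finite V] [Finite B] :
    Finite (Representation K (IntProd B) V) :=
  Finite.of_equiv _ repIntProdEquiv.symm

theorem isInvariantSubspace_intProd_iff [Finite V] [Subsingleton B]
    (X : Representation K (IntProd B) V) (U : Submodule K V) :
    IsInvariantSubspace X U ↔ U.map (repIntProdEquiv X).1.toLinearMap = U := by
  refine ⟨fun h => h (intGen B), fun h => ?_⟩
  let S : Subgroup (IntProd B) :=
    { carrier := {a | U.map (X a) = U}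
      one_mem' := by simp [Module.End.one_eq_id]
      mul_mem' := fun {a b} ha hb => by
        change U.map (X (a * b)) = U
        rw [map_mul, Module.End.mul_eq_comp, Submodule.map_comp, show U.map (X b) = U from hb, ha]
      inv_mem' := fun {a} ha => by
        change U.map (X a⁻¹) = U
        conv_lhs => rw [← show U.map (X a) = U from ha]
        rw [← Submodule.map_comp, ← Module.End.mul_eq_comp, ← map_mul]
        simp [Module.End.one_eq_id] }
  intro a
  have ha : a = intGen B ^ (Multiplicative.toAdd a.1) := by
    ext
    · simp [intGen]
    · exact Subsingleton.elim _ _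
  rw [ha]
  exact S.zpow_mem (show intGen B ∈ S from h) _

end IntProdRep

/-! ### Counting representations that preserve a given subspace -/

section LeftRange

variable {K U W V : Type*} [Field K] [AddCommGroup U] [Module K U] [AddCommGroup W]
  [Module K W] [AddCommGroup V] [Module K V]

theorem leftRange_trans (φ : (U × W) ≃ₗ[K] V) (g : V ≃ₗ[K] V) :
    leftRange (φ.trans g) = (leftRange φ).map g.toLinearMap := by
  rw [leftRange, leftRange, ← LinearMap.range_comp]
  rfl

theorem finrank_leftRange {k m n : ℕ} (φ : ((Fin k → K) × (Fin m → K)) ≃ₗ[K] (Fin n → K)) :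
    Module.finrank K (leftRange φ) = k := by
  have h : Function.Injective (φ.toLinearMap ∘ₗ LinearMap.inl K (Fin k → K) (Fin m → K)) :=
    φ.injective.comp LinearMap.inl_injective
  rw [leftRange, LinearMap.finrank_range_of_inj h]
  simp

theorem exists_leftRange_eq {n : ℕ} (S : Submodule K (Fin n → K)) :
    ∃ φ : ((Fin (Module.finrank K S) → K) × (Fin (n - Module.finrank K S) → K)) ≃ₗ[K] (Fin n → K),
      leftRange φ = S := by
  obtain ⟨T, hT⟩ := S.exists_isCompl
  have h := Submodule.finrank_add_eq_of_isCompl hT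
  rw [Module.finrank_fin_fun] at h
  let e₁ : (Fin (Module.finrank K S) → K) ≃ₗ[K] S := LinearEquiv.ofFinrankEq _ _ (by simp)
  let e₂ : (Fin (n - Module.finrank K S) → K) ≃ₗ[K] T := LinearEquiv.ofFinrankEq _ _ (by
    rw [Module.finrank_fin_fun]
    omega)
  refine ⟨(e₁.prodCongr e₂).trans (Submodule.prodEquivOfIsCompl S T hT), ?_⟩
  have : (((e₁.prodCongr e₂).trans (Submodule.prodEquivOfIsCompl S T hT)).toLinearMap ∘ₗ
      LinearMap.inl K _ _) = S.subtype ∘ₗ e₁.toLinearMap := by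
    refine LinearMap.ext fun u => ?_
    simp
  rw [leftRange, this, LinearMap.range_comp, LinearEquiv.range, Submodule.map_top,
    Submodule.range_subtype]

end LeftRange

section BlockCount

variable {K U W V B : Type*} [Field K] [AddCommGroup U] [Module K U] [AddCommGroup W]
  [Module K W] [AddCommGroup V] [Module K V] [Finite U] [Finite W] [Group B]

/-- Every pair of diagonal blocks admits the same number of cocycles, `|Hom(W, U)|`, so the sum
factors. -/
theorem finsum_lowerEulerChar_leftRange [Finite V] [Finite B] (hB : (Nat.card B : K) ≠ 0) (φ : (U × W) ≃ₗ[K] V) :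
    ∑ᶠ X : {X : Representation K (IntProd B) V // IsInvariantSubspace X (leftRange φ)},
        (lowerEulerChar X.1 (leftRange φ) : ℚ) =
      (∑ᶠ Y : Representation K (IntProd B) U, (lowerEulerChar Y ⊤ : ℚ)) *
        (Nat.card (Representation K (IntProd B) W) * Nat.card (W →ₗ[K] U)) := by
  classical
  have : Finite (W →ₗ[K] U) := DFunLike.finite _
  have : ∀ (Y : Representation K (IntProd B) U) (Z : Representation K (IntProd B) W),
      Fintype (OneCocycle (Representation.linHom Z Y)) := fun Y Z =>
    have : Finite (OneCocycle (Representation.linHom Z Y)) := by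
      refine Nat.finite_of_card_ne_zero ?_
      rw [natCard_oneCocycle _ hB]
      exact Nat.card_pos.ne'
    Fintype.ofFinite _
  have := Fintype.ofFinite (Representation K (IntProd B) U)
  have := Fintype.ofFinite (Representation K (IntProd B) W)
  rw [← finsum_comp_equiv (invariantRepEquiv φ)]
  simp only [lowerEulerChar_invariantRepEquiv]
  rw [finsum_eq_sum_of_fintype, finsum_eq_sum_of_fintype, Fintype.sum_sigma, Finset.sum_mul]
  refine Finset.sum_congr rfl fun Y _ => ?_
  rw [Fintype.sum_sigma]
  simp only [Finset.sum_const, Finset.card_univ, ← Nat.card_eq_fintype_card,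
    natCard_oneCocycle _ hB, nsmul_eq_mul]
  ring

theorem natCard_invariantRep [Finite B] (hB : (Nat.card B : K) ≠ 0) (φ : (U × W) ≃ₗ[K] V) :
    Nat.card {X : Representation K (IntProd B) V // IsInvariantSubspace X (leftRange φ)} =
      Nat.card (Representation K (IntProd B) U) *
        (Nat.card (Representation K (IntProd B) W) * Nat.card (W →ₗ[K] U)) := by
  classical
  have : Finite (W →ₗ[K] U) := DFunLike.finite _
  have : ∀ (Y : Representation K (IntProd B) U) (Z : Representation K (IntProd B) W),
      Finite (OneCocycle (Representation.linHom Z Y)) := fun Y Z => by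
    refine Nat.finite_of_card_ne_zero ?_
    rw [natCard_oneCocycle _ hB]
    exact Nat.card_pos.ne'
  have := Fintype.ofFinite (Representation K (IntProd B) U)
  have := Fintype.ofFinite (Representation K (IntProd B) W)
  rw [← Nat.card_congr (invariantRepEquiv φ), Nat.card_sigma]
  simp only [Nat.card_sigma, natCard_oneCocycle _ hB, Finset.sum_const, Finset.card_univ,
    ← Nat.card_eq_fintype_card, smul_eq_mul]

/-- For the trivial group `B`, a representation of `ℤ × B` is an automorphism. -/
noncomputable def repIntProdUnitEquiv :
    Representation K (IntProd Unit) V ≃ (V ≃ₗ[K] V) :=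
  have : ∀ g : V ≃ₗ[K] V, Unique {ρ : Representation K Unit V // ∀ b v, g (ρ b v) = ρ b (g v)} :=
    fun g =>
      { default := ⟨1, fun b v => rfl⟩
        uniq := fun ρ => Subtype.ext (MonoidHom.ext fun b => by
          rw [Subsingleton.elim b 1, map_one, map_one]) }
  repIntProdEquiv.trans (Equiv.sigmaUnique _ _)

/-- The order of a maximal parabolic subgroup comes from `natCard_invariantRep` with `B` trivial,
since a representation of `ℤ` is an automorphism. -/
theorem natCard_stabilizer_leftRange [Finite V] (φ : (U × W) ≃ₗ[K] V) :
    Nat.card {g : V ≃ₗ[K] V // (leftRange φ).map g.toLinearMap = leftRange φ} =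
      Nat.card (U ≃ₗ[K] U) * (Nat.card (W ≃ₗ[K] W) * Nat.card (W →ₗ[K] U)) := by
  rw [← Nat.card_congr (repIntProdUnitEquiv (K := K) (V := U)),
    ← Nat.card_congr (repIntProdUnitEquiv (K := K) (V := W)),
    ← natCard_invariantRep (B := Unit) (by simp) φ]
  exact (Nat.card_congr (repIntProdUnitEquiv.subtypeEquiv fun X =>
    isInvariantSubspace_intProd_iff X _)).symm

theorem natCard_leftRange_eq [Finite V] (φ : (U × W) ≃ₗ[K] V) :
    Nat.card {ψ : (U × W) ≃ₗ[K] V // leftRange ψ = leftRange φ} =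
      Nat.card (U ≃ₗ[K] U) * (Nat.card (W ≃ₗ[K] W) * Nat.card (W →ₗ[K] U)) := by
  rw [← natCard_stabilizer_leftRange φ]
  refine Nat.card_congr
    { toFun := fun ψ => ⟨φ.symm.trans ψ.1, ?_⟩
      invFun := fun g => ⟨φ.trans g.1, by rw [leftRange_trans, g.2]⟩
      left_inv := fun ψ => Subtype.ext (LinearEquiv.ext fun x => by simp)
      right_inv := fun g => Subtype.ext (LinearEquiv.ext fun x => by simp) }
  rw [← leftRange_trans, ← LinearEquiv.trans_assoc, LinearEquiv.self_trans_symm,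
    LinearEquiv.refl_trans, ψ.2]

end BlockCount

/-! ### The convolution identity -/

section Convolution

variable (K B : Type*) [Field K] [Finite K] [Group B] [Finite B]

/-- The number of automorphisms of `K ^ n`. -/
noncomputable def glCount (n : ℕ) : ℕ := Nat.card ((Fin n → K) ≃ₗ[K] (Fin n → K))

theorem glCount_pos (n : ℕ) : 0 < glCount K n := Nat.card_pos

/-- The number of representations of `ℤ × B` on `K ^ n`. -/
noncomputable def repCount (n : ℕ) : ℕ :=
  Nat.card (Representation K (IntProd B) (Fin n → K))

/-- The sum of the reduced Euler characteristics of the posets of invariant subspaces over all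
representations of `ℤ × B` on `K ^ n`. -/
noncomputable def eulerSum (n : ℕ) : ℚ :=
  ∑ᶠ X : Representation K (IntProd B) (Fin n → K), (lowerEulerChar X ⊤ : ℚ)

variable {K}

/-- Isomorphisms `K ^ k × K ^ (n - k) ≃ K ^ n` are fibred over the `k`-dimensional subspaces by the
image of the first factor, and all fibres have the order of the parabolic subgroup. -/
theorem natCard_subspaces_mul {k n : ℕ} (hk : k ≤ n) :
    Nat.card {S : Submodule K (Fin n → K) // Module.finrank K S = k} *
      (glCount K k * (glCount K (n - k) * Nat.card ((Fin (n - k) → K) →ₗ[K] (Fin k → K)))) =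
      glCount K n := by
  classical
  let Φ := ((Fin k → K) × (Fin (n - k) → K)) ≃ₗ[K] (Fin n → K)
  have hΦ : Nat.card Φ = glCount K n := by
    have e : Φ := LinearEquiv.ofFinrankEq _ _ (by simp; omega)
    exact Nat.card_congr
      { toFun := fun ψ => e.symm.trans ψ
        invFun := fun g => e.trans g
        left_inv := fun ψ => LinearEquiv.ext fun x => by simp
        right_inv := fun g => LinearEquiv.ext fun x => by simp }
  have : Finite Φ := DFunLike.finite _
  have := Fintype.ofFinite {S : Submodule K (Fin n → K) // Module.finrank K S = k}
  rw [← hΦ, ← Nat.card_congr (Equiv.sigmaFiberEquiv (fun φ : Φ =>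
    (⟨leftRange φ, finrank_leftRange φ⟩ :
      {S : Submodule K (Fin n → K) // Module.finrank K S = k}))), Nat.card_sigma,
    Finset.sum_congr rfl (g := fun _ => glCount K k * (glCount K (n - k) *
      Nat.card ((Fin (n - k) → K) →ₗ[K] (Fin k → K))))]
  · simp [Nat.card_eq_fintype_card]
  · rintro ⟨S, rfl⟩ _
    obtain ⟨φ, hφ⟩ := exists_leftRange_eq S
    rw [glCount, glCount, ← natCard_leftRange_eq φ]
    refine Nat.card_congr (Equiv.subtypeEquivRight fun ψ => ?_)
    rw [Subtype.mk.injEq, hφ]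

variable {B}

/-- Sum the weights over pairs of a representation and an invariant subspace. Summing over subspaces
first gives `0`; summing over representations first gives a contribution depending only on the
dimension `k`. The factor `|Hom|` cancels against the one in the count of subspaces. -/
theorem sum_eulerSum_mul_repCount (hB : (Nat.card B : K) ≠ 0) {n : ℕ} (hn : n ≠ 0) :
    ∑ k ∈ Finset.range (n + 1),
      eulerSum K B k / glCount K k * (repCount K B (n - k) / glCount K (n - k)) = 0 := by
  classical
  have := Fintype.ofFinite (Submodule K (Fin n → K))
  have := Fintype.ofFinite (Representation K (IntProd B) (Fin n → K))
  have : Nonempty (Fin n) := ⟨⟨0, Nat.pos_of_ne_zero hn⟩⟩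
  have h0 : ∑ X : Representation K (IntProd B) (Fin n → K),
      ∑ U ∈ Finset.univ.filter (IsInvariantSubspace X), (lowerEulerChar X U : ℚ) = 0 := by
    refine Finset.sum_eq_zero fun X _ => ?_
    exact_mod_cast sum_lowerEulerChar_eq_zero X
  have hS : ∀ S : Submodule K (Fin n → K),
      ∑ X : Representation K (IntProd B) (Fin n → K),
        (if IsInvariantSubspace X S then (lowerEulerChar X S : ℚ) else 0) =
      eulerSum K B (Module.finrank K S) * (repCount K B (n - Module.finrank K S) *
        Nat.card ((Fin (n - Module.finrank K S) → K) →ₗ[K] (Fin (Module.finrank K S) → K))) := by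
    intro S
    obtain ⟨φ, hφ⟩ := exists_leftRange_eq S
    have := finsum_lowerEulerChar_leftRange hB φ
    rw [eulerSum, repCount, ← this, hφ, finsum_eq_sum_of_fintype, ← Finset.sum_filter]
    exact Finset.sum_subtype _ (by simp) _
  simp_rw [Finset.sum_filter] at h0
  rw [Finset.sum_comm, Finset.sum_congr rfl fun S _ => hS S,
    ← Finset.sum_fiberwise_of_maps_to (t := Finset.range (n + 1))
      (g := fun S : Submodule K (Fin n → K) => Module.finrank K S)] at h0
  · have hγ : (glCount K n : ℚ) ≠ 0 := by exact_mod_cast (glCount_pos K n).ne'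
    rw [← mul_right_inj' hγ, mul_zero, ← h0, Finset.mul_sum]
    refine Finset.sum_congr rfl fun k hk => ?_
    rw [← natCard_subspaces_mul (Nat.lt_succ_iff.1 (Finset.mem_range.1 hk))]
    have h1 : (glCount K k : ℚ) ≠ 0 := by exact_mod_cast (glCount_pos K k).ne'
    have h2 : (glCount K (n - k) : ℚ) ≠ 0 := by exact_mod_cast (glCount_pos K (n - k)).ne'
    rw [Finset.sum_congr rfl (g := fun _ => eulerSum K B k * (repCount K B (n - k) *
        Nat.card ((Fin (n - k) → K) →ₗ[K] (Fin k → K))))]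
    · rw [Finset.sum_const, Nat.card_eq_fintype_card, Fintype.card_subtype, nsmul_eq_mul]
      push_cast
      field_simp
    · intro S hS
      rw [(Finset.mem_filter.1 hS).2]
  · intro S _
    rw [Finset.mem_range, Nat.lt_succ_iff]
    simpa using Submodule.finrank_le S

/-- On the zero space `⊤ = ⊥`, where the weight is `1` by convention. -/
theorem eulerSum_zero : eulerSum K B 0 = repCount K B 0 := by
  classical
  have := Fintype.ofFinite (Representation K (IntProd B) (Fin 0 → K))
  rw [eulerSum, finsum_eq_sum_of_fintype, repCount, Nat.card_eq_fintype_card]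
  simp [lowerEulerChar, Subsingleton.elim (⊤ : Submodule K (Fin 0 → K)) ⊥]

end Convolution

/-! ### Semisimple modules and their multiplicities -/

section SemisimpleModules

variable {R : Type*} [CommRing R]

/-- The semisimple module over a commutative ring with prescribed multiplicities. -/
abbrev SemisimpleModel (n : MaximalSpectrum R → ℕ) : Type _ :=
  ∀ i : MaximalSpectrum R, Fin (n i) → R ⧸ i.asIdeal

instance [Finite R] : Finite (MaximalSpectrum R) :=
  Finite.of_injective (fun i : MaximalSpectrum R => (i.asIdeal : Set R)) fun _ _ h =>
    MaximalSpectrum.ext (SetLike.coe_injective h)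

instance [Finite R] (I : Ideal R) : Finite (R ⧸ I) := Quotient.finite _

theorem exists_linearEquiv_semisimpleModel (M : Type*) [AddCommGroup M] [Module R M]
    [IsSemisimpleModule R M] [Module.Finite R M] :
    ∃ n : MaximalSpectrum R → ℕ, Nonempty (M ≃ₗ[R] SemisimpleModel n) := by
  classical
  obtain ⟨k, S, e, hS⟩ := IsSemisimpleModule.exists_linearEquiv_fin_dfinsupp R M
  have h := fun j => isSimpleModule_iff_quot_maximal.1 (hS j)
  choose I hI hSI using h
  let τ : Fin k → MaximalSpectrum R := fun j => ⟨I j, hI j⟩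
  let n : MaximalSpectrum R → ℕ := fun i => Fintype.card {j // τ j = i}
  let f : (Σ i, Fin (n i)) ≃ Fin k :=
    (Equiv.sigmaCongrRight fun i => (Fintype.equivFin {j // τ j = i}).symm).trans
      (Equiv.sigmaFiberEquiv τ)
  have hf : ∀ x, τ (f x) = x.1 := fun x => ((Fintype.equivFin {j // τ j = x.1}).symm x.2).2
  refine ⟨n, ⟨?_⟩⟩
  have e₁ : M ≃ₗ[R] ((j : Fin k) → S j) :=
    e.trans (DFinsupp.linearEquivFunOnFintype (R := R))
  have e₂ : ((j : Fin k) → S j) ≃ₗ[R] ((j : Fin k) → R ⧸ I j) :=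
    LinearEquiv.piCongrRight fun j => (hSI j).some
  have e₃ : ((x : Σ i, Fin (n i)) → R ⧸ I (f x)) ≃ₗ[R] ((j : Fin k) → R ⧸ I j) :=
    LinearEquiv.piCongrLeft R (fun j => R ⧸ I j) f
  have e₄ : ((x : Σ i, Fin (n i)) → R ⧸ I (f x)) ≃ₗ[R]
      ((x : Σ i, Fin (n i)) → R ⧸ x.1.asIdeal) := LinearEquiv.piCongrRight fun x =>
    Submodule.quotEquivOfEq _ _ (congrArg MaximalSpectrum.asIdeal (hf x))
  have e₅ : ((x : Σ i, Fin (n i)) → R ⧸ x.1.asIdeal) ≃ₗ[R] SemisimpleModel n :=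
    LinearEquiv.piCurry R fun (i : MaximalSpectrum R) (_ : Fin (n i)) => R ⧸ i.asIdeal
  exact (((e₁.trans e₂).trans e₃.symm).trans e₄).trans e₅

/-- For `j ≠ i`, some element of the maximal ideal `i` lies outside `j` and acts invertibly on `R ⧸
j`, so the `i`-torsion is exactly the `i`-th isotypic component. -/
theorem natCard_torsion_semisimpleModel (n : MaximalSpectrum R → ℕ)
    (i : MaximalSpectrum R) :
    Nat.card {x : SemisimpleModel n // ∀ r ∈ i.asIdeal, r • x = 0} =
      Nat.card (R ⧸ i.asIdeal) ^ n i := by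
  classical
  have hne : ∀ (x : SemisimpleModel n), (∀ r ∈ i.asIdeal, r • x = 0) → ∀ j ≠ i, x j = 0 := by
    intro x hx j hj
    obtain ⟨r, hr, hrj⟩ : ∃ r ∈ i.asIdeal, r ∉ j.asIdeal := by
      by_contra! h
      exact hj (MaximalSpectrum.ext (i.isMaximal.eq_of_le j.isMaximal.ne_top h).symm)
    funext l
    have h := congrFun (congrFun (hx r hr) j) l
    have hmul : Ideal.Quotient.mk j.asIdeal r * x j l = 0 := by
      exact (Algebra.smul_def r (x j l)).symm.trans h
    have := j.isMaximal
    rcases mul_eq_zero.1 hmul with h' | h'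
    · exact absurd (Ideal.Quotient.eq_zero_iff_mem.1 h') hrj
    · exact h'
  conv_rhs => rw [← Nat.card_fin (n i), ← Nat.card_fun]
  refine Nat.card_congr
    { toFun := fun x => x.1 i
      invFun := fun y => ⟨Pi.single i y, fun r hr => ?_⟩
      left_inv := fun x => Subtype.ext (funext fun j => ?_)
      right_inv := fun y => by simp }
  · rw [← Pi.single_smul]
    rw [show r • y = 0 from funext fun l => ?_, Pi.single_zero]
    change r • y l = 0
    rw [Algebra.smul_def]
    change Ideal.Quotient.mk i.asIdeal r * y l = 0
    rw [Ideal.Quotient.eq_zero_iff_mem.2 hr, zero_mul]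
  · by_cases hj : j = i
    · subst hj
      simp
    · simp [Pi.single_eq_of_ne hj, hne x.1 x.2 j hj]

theorem semisimpleModel_multiplicity_unique [Finite R] {n n' : MaximalSpectrum R → ℕ}
    (e : SemisimpleModel n ≃ₗ[R] SemisimpleModel n') : n = n' := by
  funext i
  have h : Nat.card {x : SemisimpleModel n // ∀ r ∈ i.asIdeal, r • x = 0} =
      Nat.card {x : SemisimpleModel n' // ∀ r ∈ i.asIdeal, r • x = 0} :=
    Nat.card_congr (e.toEquiv.subtypeEquiv fun x => forall₂_congr fun r _ => by
      rw [LinearEquiv.coe_toEquiv, ← map_smul, LinearEquiv.map_eq_zero_iff])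
  rw [natCard_torsion_semisimpleModel, natCard_torsion_semisimpleModel] at h
  have := Ideal.Quotient.nontrivial_iff.2 i.isMaximal.ne_top
  exact Nat.pow_right_injective (Finite.one_lt_card : 2 ≤ Nat.card (R ⧸ i.asIdeal)) h

end SemisimpleModules

/-! ### Isomorphism classes of representations of `B` -/

section Classification

variable (K B : Type*) [Field K] [CommGroup B]

instance [Finite K] [Finite B] : Finite (MonoidAlgebra K B) := Module.finite_of_finite K

/-- The maximal spectrum of the group algebra, which indexes the irreducible representations. -/
abbrev IrredRep : Type _ := MaximalSpectrum (MonoidAlgebra K B)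

variable {K B}

/-- The dimension of an irreducible representation. -/
noncomputable def IrredRep.dim (i : IrredRep K B) : ℕ :=
  Module.finrank K (MonoidAlgebra K B ⧸ i.asIdeal)

theorem IrredRep.dim_pos [Finite B] (i : IrredRep K B) : 0 < i.dim := by
  have := Ideal.Quotient.nontrivial_iff.2 i.isMaximal.ne_top
  have : Module.Finite K (MonoidAlgebra K B ⧸ i.asIdeal) := Module.Finite.of_surjective (Ideal.Quotient.mkₐ K i.asIdeal).toLinearMap
      Ideal.Quotient.mk_surjective
  exact Module.finrank_pos

variable {V W : Type*} [AddCommGroup V] [Module K V] [AddCommGroup W] [Module K W]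

/-- An intertwining isomorphism is an isomorphism of modules over the group algebra. -/
def asModuleLinearEquiv (ρ : Representation K B V) (σ : Representation K B W) (g : V ≃ₗ[K] W)
    (h : ∀ b v, g (ρ b v) = σ b (g v)) : ρ.asModule ≃ₗ[MonoidAlgebra K B] σ.asModule :=
  { ((ρ.asModuleEquiv.trans g).trans σ.asModuleEquiv.symm).toAddEquiv with
    map_smul' := fun r x => by
      change g (ρ.asAlgebraHom r (ρ.asModuleEquiv x)) = σ.asAlgebraHom r (g (ρ.asModuleEquiv x))
      induction r using MonoidAlgebra.induction_on with
      | of b => simp [h]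
      | add r s hr hs => simp [hr, hs]
      | smul c r hr => simp [hr] }


theorem nonempty_asModuleLinearEquiv_iff (ρ σ : Representation K B V) :
    Nonempty (ρ.asModule ≃ₗ[MonoidAlgebra K B] σ.asModule) ↔
      ∃ g : V ≃ₗ[K] V, conjRep g ρ = σ := by
  constructor
  · rintro ⟨e⟩
    refine ⟨(ρ.asModuleEquiv.symm.trans (e.restrictScalars K)).trans σ.asModuleEquiv,
      MonoidHom.ext fun b => LinearMap.ext fun v => ?_⟩
    change σ.asModuleEquiv (e (ρ.asModuleEquiv.symm
      (ρ b (ρ.asModuleEquiv (e.symm (σ.asModuleEquiv.symm v)))))) = σ b v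
    rw [Representation.asModuleEquiv_symm_map_rho, LinearEquiv.symm_apply_apply, map_smul,
      LinearEquiv.apply_symm_apply]
    simp
    rfl
  · rintro ⟨g, rfl⟩
    exact ⟨asModuleLinearEquiv ρ _ g fun b v => by simp⟩

variable [Finite K] [Finite B]

theorem finrank_semisimpleModel [Fintype (IrredRep K B)] (n : IrredRep K B → ℕ) :
    Module.finrank K (SemisimpleModel n) = ∑ i, n i * i.dim := by
  have : ∀ i : IrredRep K B, Module.Finite K (MonoidAlgebra K B ⧸ i.asIdeal) := fun i =>
    Module.Finite.of_finite
  rw [Module.finrank_pi_fintype]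
  refine Finset.sum_congr rfl fun i _ => ?_
  rw [Module.finrank_pi_fintype]
  simp [IrredRep.dim]

theorem exists_asModule_linearEquiv_semisimpleModel [Finite V] [Fintype (IrredRep K B)]
    (n : IrredRep K B → ℕ) (hn : ∑ i, n i * i.dim = Module.finrank K V) :
    ∃ ρ : Representation K B V, Nonempty (ρ.asModule ≃ₗ[MonoidAlgebra K B] SemisimpleModel n) := by
  have : Module.Finite K (SemisimpleModel n) := Module.Finite.of_finite
  have φ : SemisimpleModel n ≃ₗ[K] V := LinearEquiv.ofFinrankEq _ _ (by
    rw [finrank_semisimpleModel, hn])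
  let σ : Representation K B (SemisimpleModel n) := Representation.ofModule' (SemisimpleModel n)
  have e : σ.asModule ≃ₗ[MonoidAlgebra K B] SemisimpleModel n :=
    { σ.asModuleEquiv.toAddEquiv with
      map_smul' := fun r x => by
        change σ.asAlgebraHom r (σ.asModuleEquiv x) = r • (σ.asModuleEquiv x)
        induction r using MonoidAlgebra.induction_on with
        | of b => simp [σ, Representation.ofModule']
        | add r s hr hs => simp [hr, hs, add_smul]
        | smul c r hr => simp [hr] }
  exact ⟨conjRep φ σ, ⟨(asModuleLinearEquiv σ _ φ fun b v => by simp).symm.trans e⟩⟩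

instance conjRepAction : MulAction (V ≃ₗ[K] V) (Representation K B V) where
  smul g ρ := conjRep g ρ
  one_smul _ := rfl
  mul_smul _ _ _ := rfl

/-- By Maschke every representation is semisimple, so its multiplicities are a complete invariant;
only the dimension of `V` constrains them. -/
theorem natCard_isoClasses [Finite V] [Fintype (IrredRep K B)] (hB : (Nat.card B : K) ≠ 0) :
    Nat.card (MulAction.orbitRel.Quotient (V ≃ₗ[K] V) (Representation K B V)) =
      Nat.card {n : IrredRep K B → ℕ // ∑ i, n i * i.dim = Module.finrank K V} := by
  have : NeZero (Nat.card B : K) := ⟨hB⟩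
  have hex : ∀ ρ : Representation K B V, ∃ n : IrredRep K B → ℕ,
      Nonempty (ρ.asModule ≃ₗ[MonoidAlgebra K B] SemisimpleModel n) := fun ρ => by
    have : Finite ρ.asModule := Finite.of_equiv _ ρ.asModuleEquiv.symm.toEquiv
    have : Module.Finite (MonoidAlgebra K B) ρ.asModule := Module.Finite.of_finite
    exact exists_linearEquiv_semisimpleModel ρ.asModule
  choose τ hτ using hex
  have hτ_iff : ∀ ρ σ : Representation K B V, τ ρ = τ σ ↔ ∃ g : V ≃ₗ[K] V, conjRep g ρ = σ := by
    intro ρ σ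
    rw [← nonempty_asModuleLinearEquiv_iff]
    constructor
    · intro h
      obtain ⟨e⟩ := hτ ρ
      obtain ⟨f⟩ := hτ σ
      rw [h] at e
      exact ⟨e.trans f.symm⟩
    · rintro ⟨e⟩
      exact semisimpleModel_multiplicity_unique
        (((hτ ρ).some.symm.trans e).trans (hτ σ).some)
  have hrank : ∀ ρ, ∑ i, τ ρ i * i.dim = Module.finrank K V := fun ρ => by
    rw [← finrank_semisimpleModel, ← ((hτ ρ).some.restrictScalars K).finrank_eq,
      ρ.asModuleEquiv.finrank_eq]
  refine Nat.card_eq_of_bijective (Quotient.lift (fun ρ => ⟨τ ρ, hrank ρ⟩) ?_) ⟨?_, ?_⟩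
  · rintro ρ σ ⟨g, hg⟩
    exact Subtype.ext ((hτ_iff σ ρ).2 ⟨g, hg⟩).symm
  · rintro ⟨ρ⟩ ⟨σ⟩ h
    obtain ⟨g, hg⟩ := (hτ_iff σ ρ).1 (congrArg Subtype.val h).symm
    exact Quotient.sound ⟨g, hg⟩
  · rintro ⟨n, hn⟩
    obtain ⟨ρ, ⟨e⟩⟩ := exists_asModule_linearEquiv_semisimpleModel (V := V) n hn
    exact ⟨Quotient.mk _ ρ, Subtype.ext
      (semisimpleModel_multiplicity_unique ((hτ ρ).some.symm.trans e))⟩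

/-- A representation of `ℤ × B` is a pair `(g, ρ)` with `ρ` fixed under conjugation by `g`;
Burnside's lemma counts such pairs as orbits times group order. -/
theorem repCount_eq [Fintype (IrredRep K B)] (hB : (Nat.card B : K) ≠ 0) (n : ℕ) :
    repCount K B n =
      Nat.card {m : IrredRep K B → ℕ // ∑ i, m i * i.dim = n} * glCount K n := by
  have h := natCard_isoClasses (V := Fin n → K) hB
  rw [Module.finrank_fin_fun] at h
  rw [← h, glCount, ← Nat.card_prod, repCount, Nat.card_congr repIntProdEquiv,
    ← Nat.card_congr (MulAction.sigmaFixedByEquivOrbitsProdGroup ((Fin n → K) ≃ₗ[K] (Fin n → K))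
      (Representation K B (Fin n → K)))]
  refine Nat.card_congr (Equiv.sigmaCongrRight fun g => Equiv.subtypeEquivRight fun ρ => ?_)
  constructor
  · intro h
    refine MonoidHom.ext fun b => LinearMap.ext fun v => ?_
    change g (ρ b (g.symm v)) = ρ b v
    rw [h, LinearEquiv.apply_symm_apply]
  · intro h b v
    have := DFunLike.congr_fun (DFunLike.congr_fun h b) (g v)
    change g (ρ b (g.symm (g v))) = ρ b (g v) at this
    rwa [LinearEquiv.symm_apply_apply] at this

end Classification

/-! ### The product formula -/

section Products

open PowerSeries

/-- The power series `∑ X ^ (d * k)`. -/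
noncomputable def geometricSeries (d : ℕ) : ℚ⟦X⟧ := PowerSeries.mk fun n => if d ∣ n then 1 else 0

theorem geometricSeries_mul_one_sub {d : ℕ} (hd : 0 < d) :
    geometricSeries d * (1 - X ^ d) = 1 := by
  ext n
  rw [mul_sub, mul_one, map_sub, coeff_mul_X_pow', geometricSeries, coeff_mk, coeff_one]
  by_cases hn : n = 0
  · subst hn
    simp [hd.ne']
  by_cases hdn : d ≤ n
  · have h : d ∣ n - d ↔ d ∣ n := by
      rw [← Nat.dvd_add_left (dvd_refl d), Nat.sub_add_cancel hdn]
    simp [hdn, hn, h]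
  · rw [if_neg hdn, if_neg hn, if_neg fun h => hdn (Nat.le_of_dvd (Nat.pos_of_ne_zero hn) h),
      sub_zero]

theorem coeff_prod_geometricSeries {ι : Type*} [Fintype ι] (d : ι → ℕ) (hd : ∀ i, 0 < d i)
    (n : ℕ) :
    coeff n (∏ i, geometricSeries (d i)) =
      (Nat.card {m : ι → ℕ // ∑ i, m i * d i = n} : ℚ) := by
  classical
  rw [coeff_prod]
  have h : ∀ l : ι →₀ ℕ, ∏ i, coeff (l i) (geometricSeries (d i)) =
      if ∀ i, d i ∣ l i then 1 else 0 := by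
    intro l
    simp only [geometricSeries, coeff_mk, Finset.prod_ite_zero, Finset.mem_univ, true_imp_iff,
      Finset.prod_const_one]
  rw [Finset.sum_congr rfl fun l _ => h l, ← Finset.sum_filter, Finset.sum_const, nsmul_eq_mul,
    mul_one, ← Nat.card_eq_finsetCard]
  congr 1
  refine Nat.card_congr
    { toFun := fun l => ⟨fun i => l.1 i / d i, ?_⟩
      invFun := fun m => ⟨Finsupp.equivFunOnFinite.symm fun i => m.1 i * d i, ?_⟩
      left_inv := fun l => Subtype.ext (Finsupp.ext fun i => ?_)
      right_inv := fun m => Subtype.ext (funext fun i => ?_) }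
  · have := Finset.mem_filter.1 l.2
    rw [Finset.mem_finsuppAntidiag] at this
    exact (Finset.sum_congr rfl fun i _ => Nat.div_mul_cancel (this.2 i)).trans this.1.1
  · rw [Finset.mem_filter, Finset.mem_finsuppAntidiag]
    exact ⟨⟨m.2, Finset.subset_univ _⟩, fun i => dvd_mul_left _ _⟩
  · exact Nat.div_mul_cancel ((Finset.mem_filter.1 l.2).2 i)
  · exact Nat.mul_div_cancel _ (hd i)

variable (K B : Type*) [Field K] [Finite K] [CommGroup B] [Finite B]

/-- The generating function of the equivariant reduced Euler characteristics with respect to the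
group `ℤ × B`. -/
noncomputable def eulerSeries : ℚ⟦X⟧ := PowerSeries.mk fun n => eulerSum K B n / glCount K n

variable {K B}

/-- Both sides are inverse to the series of normalised representation counts, which is a product of
geometric series. -/
theorem eulerSeries_eq_prod [Fintype (IrredRep K B)] (hB : (Nat.card B : K) ≠ 0) :
    eulerSeries K B = ∏ i : IrredRep K B, (1 - X ^ i.dim) := by
  have hG : ∀ n, (glCount K n : ℚ) ≠ 0 := fun n => by exact_mod_cast (glCount_pos K n).ne'
  have hH : (PowerSeries.mk fun n => (repCount K B n : ℚ) / glCount K n) =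
      ∏ i : IrredRep K B, geometricSeries i.dim := by
    ext n
    rw [coeff_prod_geometricSeries _ IrredRep.dim_pos, coeff_mk, repCount_eq hB]
    push_cast
    exact mul_div_cancel_right₀ _ (hG n)
  have hFH : eulerSeries K B * (PowerSeries.mk fun n => (repCount K B n : ℚ) / glCount K n) = 1 := by
    ext n
    rw [coeff_mul, Finset.Nat.sum_antidiagonal_eq_sum_range_succ_mk, coeff_one]
    simp only [eulerSeries, coeff_mk]
    by_cases hn : n = 0
    · subst hn
      have h0 : repCount K B 0 = glCount K 0 := by
        rw [repCount_eq hB]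
        have : Nat.card {m : IrredRep K B → ℕ // ∑ i, m i * i.dim = 0} = 1 := by
          rw [Nat.card_eq_one_iff_unique]
          refine ⟨⟨fun a b => Subtype.ext (funext fun i => ?_)⟩, ⟨⟨0, by simp⟩⟩⟩
          have ha := Finset.sum_eq_zero_iff.1 a.2 i (Finset.mem_univ i)
          have hb := Finset.sum_eq_zero_iff.1 b.2 i (Finset.mem_univ i)
          rw [(Nat.mul_eq_zero.1 ha).resolve_right i.dim_pos.ne',
            (Nat.mul_eq_zero.1 hb).resolve_right i.dim_pos.ne']
        rw [this, one_mul]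
      simp [eulerSum_zero, h0, hG]
    · rw [if_neg hn]
      exact sum_eulerSum_mul_repCount hB hn
  have hprod : (∏ i : IrredRep K B, geometricSeries i.dim) *
      ∏ i : IrredRep K B, (1 - X ^ i.dim : ℚ⟦X⟧) = 1 := by
    rw [← Finset.prod_mul_distrib]
    exact Finset.prod_eq_one fun i _ => geometricSeries_mul_one_sub i.dim_pos
  rw [hH] at hFH
  exact left_inv_eq_right_inv hFH hprod

end Products

/-! ### Characters and dimensions of irreducible representations -/

theorem natCard_monoidHom_eq_one {B F : Type*} [CommGroup B] [Field F]
    (h : (Nat.card B).Coprime (Nat.card F - 1)) :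
    Nat.card (B →* F) = 1 := by
  rw [Nat.card_eq_one_iff_unique]
  have key : ∀ (f : B →* F) (b : B), f b = 1 := by
    intro f b
    have h1 : f.toHomUnits b ^ Nat.card B = 1 := by rw [← map_pow, pow_card_eq_one', map_one]
    have h2 : f.toHomUnits b ^ (Nat.card F - 1) = 1 := by
      rw [← Nat.card_units, pow_card_eq_one']
    have h3 : f.toHomUnits b = 1 := by
      rw [← orderOf_eq_one_iff]
      exact Nat.eq_one_of_dvd_coprimes h (orderOf_dvd_of_pow_eq_one h1)
        (orderOf_dvd_of_pow_eq_one h2)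
    exact congrArg Units.val h3
  exact ⟨⟨fun f g => MonoidHom.ext fun b => by rw [key, key]⟩, ⟨1⟩⟩

section Characters

variable {K B F : Type*} [Field K] [Finite K] [CommGroup B] [Finite B] [Field F] [Algebra K F]

/-- Algebra homomorphisms from the group algebra to a field factor through a residue field. -/
theorem bijective_comp_quotient_mk :
    Function.Bijective fun x : (Σ i : IrredRep K B, (MonoidAlgebra K B ⧸ i.asIdeal) →ₐ[K] F) =>
      x.2.comp (Ideal.Quotient.mkₐ K x.1.asIdeal) := by
  constructor
  · rintro ⟨i, f⟩ ⟨j, g⟩ h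
    have hker : ∀ (i : IrredRep K B) (f : (MonoidAlgebra K B ⧸ i.asIdeal) →ₐ[K] F)
        (x : MonoidAlgebra K B), f.comp (Ideal.Quotient.mkₐ K i.asIdeal) x = 0 ↔ x ∈ i.asIdeal := by
      intro i f x
      have := i.isMaximal
      let := Ideal.Quotient.field i.asIdeal
      rw [AlgHom.comp_apply, map_eq_zero_iff f f.toRingHom.injective]
      exact Ideal.Quotient.eq_zero_iff_mem
    obtain rfl : i = j := by
      refine MaximalSpectrum.ext (Ideal.ext fun x => ?_)
      rw [← hker i f, ← hker j g]
      exact iff_of_eq (congrArg (· x = 0) h)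
    exact congrArg _ (Ideal.Quotient.algHom_ext K h)
  · intro f
    have hp : (RingHom.ker f).IsPrime := RingHom.ker_isPrime f
    -- The group algebra is finite, so its prime ideals are maximal.
    have hm : (RingHom.ker f).IsMaximal := Ideal.IsPrime.isMaximal' hp
    exact ⟨⟨⟨RingHom.ker f, hm⟩, Ideal.Quotient.liftₐ (RingHom.ker f) f fun a ha => ha⟩,
      AlgHom.ext fun x => rfl⟩

/-- A character `B → F` is an algebra map `K[B] → F`, hence an embedding of some residue field. A
finite field of degree `d` over `K` has `d` embeddings into `F` if `d ∣ [F : K]`, and none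
otherwise. -/
theorem sum_dim_dvd_eq_natCard_monoidHom [Finite F] [Fintype (IrredRep K B)] :
    ∑ i : IrredRep K B with i.dim ∣ Module.finrank K F, i.dim = Nat.card (B →* F) := by
  have : ∀ i : IrredRep K B, Finite ((MonoidAlgebra K B ⧸ i.asIdeal) →ₐ[K] F) := fun i =>
    DFunLike.finite _
  rw [Nat.card_congr (MonoidAlgebra.lift K F B),
    ← Nat.card_congr (Equiv.ofBijective _ (bijective_comp_quotient_mk (K := K) (B := B) (F := F))),
    Nat.card_sigma, Finset.sum_filter]
  refine Finset.sum_congr rfl fun i _ => ?_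
  have := i.isMaximal
  let := Ideal.Quotient.field i.asIdeal
  split_ifs with h
  · exact (FiniteField.natCard_algHom_of_finrank_dvd h).symm
  · rw [eq_comm, Nat.card_eq_zero]
    left
    by_contra hne
    rw [not_isEmpty_iff] at hne
    exact h (FiniteField.nonempty_algHom_iff_finrank_dvd.1 hne)

end Characters

/-! ### Comparison of the dimensions over the two fields -/

/-- The sum at `n` is `∑ d * count d` over `d ∣ n`, so multiplicities are recovered by induction
along divisors. A multiplicity of `0` would be invisible, hence the exclusions. -/
theorem Multiset.eq_of_forall_sum_filter_dvd_eq {s s' : Multiset ℕ} (hs : 0 ∉ s) (hs' : 0 ∉ s')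
    (h : ∀ n ≠ 0, (s.filter (· ∣ n)).sum = (s'.filter (· ∣ n)).sum) : s = s' := by
  have key : ∀ (s : Multiset ℕ) (n : ℕ), n ≠ 0 →
      (s.filter (· ∣ n)).sum = ∑ d ∈ n.divisors, s.count d * d := by
    intro s n hn
    induction s using Multiset.induction_on with
    | empty => simp
    | cons a s ih =>
      simp only [Multiset.count_cons, add_mul, Finset.sum_add_distrib]
      rw [← ih, Multiset.filter_cons]
      split_ifs with ha
      · simp [hn, ha, add_comm]
      · simp [ha]
  ext n
  induction n using Nat.strong_induction_on with
  | _ n ih =>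
    rcases Nat.eq_zero_or_pos n with rfl | hn
    · rw [Multiset.count_eq_zero_of_notMem hs, Multiset.count_eq_zero_of_notMem hs']
    · have h1 := h n hn.ne'
      rw [key s n hn.ne', key s' n hn.ne', ← Nat.cons_self_properDivisors hn.ne',
        Finset.sum_cons, Finset.sum_cons,
        Finset.sum_congr rfl fun d hd => by rw [ih d (Nat.mem_properDivisors.1 hd).2]] at h1
      exact Nat.eq_of_mul_eq_mul_right hn (Nat.add_right_cancel h1)

section Comparison

open PowerSeries

variable {K L B : Type*} [Field K] [Finite K] [Field L] [Finite L] [CommGroup B] [Finite B]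

/-- Both sides count characters of `B` in finite fields of equal order, which are isomorphic. -/
theorem sum_dim_dvd_eq_of_natCard_eq [Fintype (IrredRep K B)] [Fintype (IrredRep L B)] {m n : ℕ}
    (hm : m ≠ 0) (hn : n ≠ 0) (h : Nat.card K ^ m = Nat.card L ^ n) :
    ∑ i : IrredRep K B with i.dim ∣ m, i.dim = ∑ i : IrredRep L B with i.dim ∣ n, i.dim := by
  have : NeZero m := ⟨hm⟩
  have : NeZero n := ⟨hn⟩
  obtain ⟨ℓ, hℓ⟩ := CharP.exists K
  obtain ⟨ℓ', hℓ'⟩ := CharP.exists L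
  have : Fact ℓ.Prime := ⟨CharP.char_is_prime K ℓ⟩
  have : Fact ℓ'.Prime := ⟨CharP.char_is_prime L ℓ'⟩
  let F := FiniteField.Extension K ℓ m
  let F' := FiniteField.Extension L ℓ' n
  have hF := sum_dim_dvd_eq_natCard_monoidHom (K := K) (B := B) (F := F)
  have hF' := sum_dim_dvd_eq_natCard_monoidHom (K := L) (B := B) (F := F')
  rw [FiniteField.finrank_extension] at hF hF'
  rw [hF, hF']
  have := Fintype.ofFinite F
  have := Fintype.ofFinite F'
  let e : F ≃+* F' := FiniteField.ringEquivOfCardEq (by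
    rw [← Nat.card_eq_fintype_card, ← Nat.card_eq_fintype_card, FiniteField.natCard_extension,
      FiniteField.natCard_extension, h])
  exact Nat.card_congr e.toMulEquiv.monoidHomCongrRightEquiv

theorem sum_dim_dvd_eq_one [Fintype (IrredRep K B)] {n : ℕ} (hn : n ≠ 0)
    (h : (Nat.card B).Coprime (Nat.card K ^ n - 1)) :
    ∑ i : IrredRep K B with i.dim ∣ n, i.dim = 1 := by
  have : NeZero n := ⟨hn⟩
  obtain ⟨ℓ, hℓ⟩ := CharP.exists K
  have : Fact ℓ.Prime := ⟨CharP.char_is_prime K ℓ⟩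
  have hF := sum_dim_dvd_eq_natCard_monoidHom (K := K) (B := B) (F := FiniteField.Extension K ℓ n)
  rw [FiniteField.finrank_extension] at hF
  rw [hF]
  refine natCard_monoidHom_eq_one ?_
  rwa [FiniteField.natCard_extension]

theorem eulerSeries_identity {t : ℕ} (ht : t ≠ 0) (hBK : (Nat.card B : K) ≠ 0)
    (hBL : (Nat.card B : L) ≠ 0) (hL : Nat.card L = Nat.card K ^ t)
    (hcop : ∀ n, ¬ t ∣ n → (Nat.card B).Coprime (Nat.card K ^ n - 1)) :
    (1 - (X : ℚ⟦X⟧) ^ t) * eulerSeries K B ^ t =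
      (1 - (X : ℚ⟦X⟧)) ^ t * PowerSeries.subst ((X : ℚ⟦X⟧) ^ t) (eulerSeries L B) := by
  have := Fintype.ofFinite (IrredRep K B)
  have := Fintype.ofFinite (IrredRep L B)
  let sK : Multiset ℕ := Finset.univ.val.map fun i : IrredRep K B => i.dim
  let sL : Multiset ℕ := Finset.univ.val.map fun i : IrredRep L B => i.dim
  have hfilter : ∀ n, (sK.filter (· ∣ n)).sum = ∑ i : IrredRep K B with i.dim ∣ n, i.dim := by
    intro n
    rw [Multiset.filter_map]
    rfl
  have hfilterL : ∀ n, (sL.filter (· ∣ n)).sum = ∑ i : IrredRep L B with i.dim ∣ n, i.dim := by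
    intro n
    rw [Multiset.filter_map]
    rfl
  -- This is the identity at the level of exponents. At `n` with `t ∤ n` both divisor sums are `t`;
  -- at `n = t * m` both are `t` plus `t` times the common number of characters.
  have hmain : t • sK + {t} = t • {1} + sL.map (t * ·) := by
    refine Multiset.eq_of_forall_sum_filter_dvd_eq ?_ ?_ fun n hn => ?_
    · simp only [Multiset.mem_add, Multiset.mem_nsmul, Multiset.mem_singleton, not_or, not_and]
      refine ⟨fun _ h => ?_, ht.symm⟩
      obtain ⟨i, _, hi⟩ := Multiset.mem_map.1 h
      exact i.dim_pos.ne' hi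
    · simp only [Multiset.mem_add, Multiset.mem_nsmul, Multiset.mem_singleton, not_or, not_and]
      refine ⟨fun _ => zero_ne_one, fun h => ?_⟩
      obtain ⟨d, hd, h0⟩ := Multiset.mem_map.1 h
      obtain ⟨i, _, rfl⟩ := Multiset.mem_map.1 hd
      exact (Nat.mul_pos (Nat.pos_of_ne_zero ht) i.dim_pos).ne' h0
    · rw [Multiset.filter_add, Multiset.filter_add, Multiset.filter_nsmul, Multiset.filter_nsmul,
        Multiset.sum_add, Multiset.sum_add, Multiset.sum_nsmul, Multiset.sum_nsmul, hfilter,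
        Multiset.filter_map, Multiset.filter_singleton, Multiset.filter_singleton,
        Multiset.sum_map_mul_left, Multiset.map_id', if_pos (one_dvd n)]
      by_cases htn : t ∣ n
      · obtain ⟨m, rfl⟩ := htn
        have hm : m ≠ 0 := right_ne_zero_of_mul hn
        have : sL.filter ((· ∣ t * m) ∘ (t * ·)) = sL.filter (· ∣ m) :=
          Multiset.filter_congr fun d _ => Nat.mul_dvd_mul_iff_left (Nat.pos_of_ne_zero ht)
        rw [if_pos (dvd_mul_right t m), this, hfilterL, sum_dim_dvd_eq_of_natCard_eq (K := K)
          (L := L) hn hm (by rw [hL, pow_mul])]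
        simp
        ring
      · have : sL.filter ((· ∣ n) ∘ (t * ·)) = 0 :=
          Multiset.filter_eq_nil.2 fun d _ h => htn ((dvd_mul_right t d).trans h)
        rw [if_neg htn, this, sum_dim_dvd_eq_one hn (hcop n htn)]
        simp
  have hsub : PowerSeries.HasSubst ((X : ℚ⟦X⟧) ^ t) := HasSubst.X_pow ht
  have hprod := congrArg (fun s : Multiset ℕ => (s.map fun d => (1 - X ^ d : ℚ⟦X⟧)).prod) hmain
  simp only [Multiset.map_add, Multiset.map_nsmul, Multiset.prod_add, Multiset.prod_nsmul,
    Multiset.map_singleton, Multiset.prod_singleton, Multiset.map_map, pow_one] at hprod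
  rw [eulerSeries_eq_prod hBK, eulerSeries_eq_prod hBL, ← coe_substAlgHom hsub, map_prod, mul_comm]
  refine Eq.trans ?_ (hprod.trans ?_)
  · simp only [sK, Multiset.map_map]
    rfl
  · simp only [sL, Multiset.map_map]
    congr 1
    refine Finset.prod_congr rfl fun i _ => ?_
    rw [map_sub, map_one, map_pow, coe_substAlgHom, subst_X hsub, ← pow_mul]
    rfl

end Comparison

/-! ### Reduction from `ℤ_p` to `ℤ/p^N` -/

section PrimaryGroup

variable (p r N : ℕ) [Fact p.Prime]

/-- The group `(ℤ / p ^ N) ^ (r - 1)`, written multiplicatively. -/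
abbrev TruncatedGroup : Type := Multiplicative (Fin (r - 1) → ZMod (p ^ N))

instance : NeZero (p ^ N) := ⟨pow_ne_zero _ (Fact.out : p.Prime).ne_zero⟩

theorem natCard_truncatedGroup : Nat.card (TruncatedGroup p r N) = (p ^ N) ^ (r - 1) := by
  rw [Nat.card_congr Multiplicative.toAdd]
  simp

/-- Reduction modulo `p ^ N`. -/
noncomputable def truncation : PrimaryGroup p r →* IntProd (TruncatedGroup p r N) where
  toFun x := (Multiplicative.ofAdd x.toAdd.1,
    Multiplicative.ofAdd fun i => PadicInt.toZModPow N (x.toAdd.2 i))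
  map_one' := by
    refine Prod.ext rfl ?_
    exact congrArg Multiplicative.ofAdd (funext fun i => map_zero (PadicInt.toZModPow N))
  map_mul' x y := by
    refine Prod.ext rfl ?_
    exact congrArg Multiplicative.ofAdd (funext fun i => map_add (PadicInt.toZModPow N) _ _)

theorem truncation_surjective : Function.Surjective (truncation p r N) := by
  rintro ⟨k, b⟩
  choose y hy using fun i => ZMod.ringHom_surjective (PadicInt.toZModPow (p := p) N)
    (Multiplicative.toAdd b i)
  exact ⟨Multiplicative.ofAdd (Multiplicative.toAdd k, y), Prod.ext rfl
    (congrArg Multiplicative.ofAdd (funext hy))⟩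

variable {p r N}

theorem exists_eq_nsmul_of_toZModPow_eq_zero {c : ℕ} (hc : c ≠ 0) (hN : c ≤ N) {x : ℤ_[p]}
    (hx : PadicInt.toZModPow N x = 0) : ∃ y : ℤ_[p], x = c • y := by
  obtain ⟨v, m, hm, hcm⟩ := Nat.exists_eq_pow_mul_and_not_dvd hc p (Fact.out : p.Prime).ne_one
  -- The crude bound `c ≤ N` suffices, as `v < p ^ v ≤ c`; the prime-to-`p` part `m` of `c` is a
  -- unit in `ℤ_p`.
  have hvN : v ≤ N := by
    have h1 : v < p ^ v := Nat.lt_pow_self (Fact.out : p.Prime).one_lt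
    have h2 : p ^ v ≤ c := Nat.le_of_dvd (Nat.pos_of_ne_zero hc) ⟨m, hcm⟩
    omega
  have hu : IsUnit ((m : ℤ_[p])) := by
    rw [PadicInt.isUnit_iff]
    have := (PadicInt.norm_int_lt_one_iff_dvd (p := p) (m : ℤ)).not.2
      (by exact_mod_cast hm)
    exact le_antisymm (PadicInt.norm_le_one _) (not_lt.1 (by simpa using this))
  obtain ⟨w, hw⟩ := hu
  rw [← RingHom.mem_ker, PadicInt.ker_toZModPow, Ideal.mem_span_singleton] at hx
  obtain ⟨z, rfl⟩ := hx
  refine ⟨↑w⁻¹ * (p : ℤ_[p]) ^ (N - v) * z, ?_⟩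
  have hw' : (m : ℤ_[p]) * (↑w⁻¹ : ℤ_[p]) = 1 := by rw [← hw]; simp
  rw [hcm, nsmul_eq_mul, ← Nat.add_sub_cancel' hvN, pow_add, Nat.add_sub_cancel' hvN]
  push_cast
  linear_combination (-(p : ℤ_[p]) ^ v * (p : ℤ_[p]) ^ (N - v) * z) * hw'

/-- Every element of the kernel of the truncation is a `|G|`-th power, so it dies in `G`. -/
theorem ker_truncation_le {G : Type*} [Group G] [Finite G] (hN : Nat.card G ≤ N)
    (X : PrimaryGroup p r →* G) : (truncation p r N).ker ≤ X.ker := by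
  intro x hx
  rw [MonoidHom.mem_ker] at hx ⊢
  have h1 : x.toAdd.1 = 0 := congrArg (fun y => Multiplicative.toAdd (Prod.fst y)) hx
  have h2 : ∀ i, PadicInt.toZModPow N (x.toAdd.2 i) = 0 := fun i =>
    congrFun (congrArg (fun y => Multiplicative.toAdd (Prod.snd y)) hx) i
  choose y hy using fun i =>
    exists_eq_nsmul_of_toZModPow_eq_zero (Nat.card_pos (α := G)).ne' hN (h2 i)
  have hxy : x = Multiplicative.ofAdd ((0 : ℤ), y) ^ Nat.card G := by
    rw [← ofAdd_nsmul]
    apply Multiplicative.toAdd.injective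
    rw [toAdd_ofAdd]
    refine Prod.ext ?_ (funext hy)
    simp [h1]
  rw [hxy, map_pow, pow_card_eq_one']

variable {K V : Type*} [Field K] [AddCommGroup V] [Module K V]

theorem bijective_comp_truncation [Finite V]
    (hN : Nat.card (LinearMap.GeneralLinearGroup K V) ≤ N) :
    Function.Bijective fun ρ : Representation K (IntProd (TruncatedGroup p r N)) V =>
      ((MonoidHom.toHomUnits ρ).comp (truncation p r N) :
        PrimaryGroup p r →* LinearMap.GeneralLinearGroup K V) := by
  constructor
  · intro ρ σ h
    refine MonoidHom.ext fun a => ?_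
    obtain ⟨x, rfl⟩ := truncation_surjective p r N a
    exact congrArg Units.val (DFunLike.congr_fun h x)
  · intro X
    let Y := (truncation p r N).liftOfSurjective (truncation_surjective p r N)
      ⟨X, ker_truncation_le hN X⟩
    have hY : ∀ x, Y (truncation p r N x) = X x := fun x =>
      MonoidHom.liftOfRightInverse_comp_apply _ _
        (Function.rightInverse_surjInv (truncation_surjective p r N)) ⟨X, ker_truncation_le hN X⟩ x
    refine ⟨(Units.coeHom _).comp Y, MonoidHom.ext fun x => Units.ext ?_⟩
    change (Y (truncation p r N x)).val = (X x).val
    rw [hY]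

theorem reducedEulerChar_invariantSubspaces [Finite V] [Nontrivial V]
    (ρ : Representation K (IntProd (TruncatedGroup p r N)) V) :
    reducedEulerChar (InvariantSubspaces ((MonoidHom.toHomUnits ρ).comp (truncation p r N) :
        PrimaryGroup p r →* LinearMap.GeneralLinearGroup K V)) = lowerEulerChar ρ ⊤ := by
  rw [lowerEulerChar, if_neg top_ne_bot]
  have h : ∀ U : Submodule K V, (U ≠ ⊥ ∧ U ≠ ⊤ ∧ ∀ a : PrimaryGroup p r,
      U.map (((MonoidHom.toHomUnits ρ).comp (truncation p r N) a : Module.End K V)) = U) ↔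
      U ≠ ⊥ ∧ U < ⊤ ∧ IsInvariantSubspace ρ U := fun U => by
    rw [lt_top_iff_ne_top, IsInvariantSubspace, (truncation_surjective p r N).forall]
    rfl
  exact reducedEulerChar_congr
    { toEquiv := Equiv.subtypeEquivRight h
      map_rel_iff' := Iff.rfl }

variable [Finite K]

theorem coeff_primaryGenFun (hB : (Nat.card (TruncatedGroup p r N) : K) ≠ 0) (n : ℕ)
    (hN : Nat.card (LinearMap.GeneralLinearGroup K (Fin n → K)) ≤ N) :
    PowerSeries.coeff n (primaryGenFun p r K) =
      PowerSeries.coeff n (eulerSeries K (TruncatedGroup p r N)) := by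
  rcases Nat.eq_zero_or_pos n with rfl | hn
  · have := Fintype.ofFinite (IrredRep K (TruncatedGroup p r N))
    rw [eulerSeries_eq_prod hB, primaryGenFun, PowerSeries.coeff_mk, if_pos rfl,
      PowerSeries.coeff_zero_eq_constantCoeff_apply, map_prod]
    exact (Finset.prod_eq_one fun i _ => by simp [i.dim_pos.ne']).symm
  · have : Nonempty (Fin n) := ⟨⟨0, hn⟩⟩
    rw [primaryGenFun, PowerSeries.coeff_mk, if_neg hn.ne', eulerSeries, PowerSeries.coeff_mk,
      primaryEulerChar, glCount,
      Nat.card_congr (LinearMap.GeneralLinearGroup.generalLinearEquiv K (Fin n → K)).toEquiv,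
      eulerSum]
    congr 1
    exact (finsum_eq_of_bijective _ (bijective_comp_truncation hN) fun ρ => by
      rw [reducedEulerChar_invariantSubspaces]).symm

end PrimaryGroup

/-! ### Arithmetic of `g` and the conclusion -/

/-- If `g ^ m ≡ 1` modulo `p`, then `g ^ (m * p) ≡ 1` modulo `p ^ 2`, so the order `p * (p - 1)`
divides `m * p`. -/
theorem not_dvd_pow_sub_one_of_orderOf_eq {p g m : ℕ} [Fact p.Prime] (hg : 0 < g)
    (hgp : orderOf (g : ZMod (p ^ 2)) = Nat.totient (p ^ 2)) (h : ¬ (p - 1) ∣ m) :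
    ¬ p ∣ g ^ m - 1 := by
  intro hp
  have hp' : (p : ℤ) ∣ (g : ℤ) ^ m - 1 := by
    have := Int.natCast_dvd_natCast.2 hp
    rwa [Nat.cast_sub (Nat.one_le_pow _ _ hg), Nat.cast_pow, Nat.cast_one] at this
  have h2 := dvd_sub_pow_of_dvd_sub hp' 1
  rw [one_pow, pow_one, ← pow_mul] at h2
  have h3 : (g : ZMod (p ^ 2)) ^ (m * p) = 1 := by
    have := (ZMod.intCast_zmod_eq_zero_iff_dvd ((g : ℤ) ^ (m * p) - 1) (p ^ 2)).2
      (by exact_mod_cast h2)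
    push_cast at this
    rwa [sub_eq_zero] at this
  have h4 := orderOf_dvd_of_pow_eq_one h3
  rw [hgp, Nat.totient_prime_pow Fact.out two_pos, show 2 - 1 = 1 from rfl, pow_one,
    mul_comm] at h4
  exact h (Nat.dvd_of_mul_dvd_mul_right (Fact.out : p.Prime).pos h4)

theorem natCast_ne_zero_of_natCard_eq_pow {K : Type*} [Field K] [Finite K] {g k c : ℕ}
    (hK : Nat.card K = g ^ k) (h : g.Coprime c) : (c : K) ≠ 0 := by
  intro hc
  have hg : (g : K) = 0 := by
    have := Fintype.ofFinite K
    have h0 : ((Nat.card K : ℕ) : K) = 0 := by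
      rw [Nat.card_eq_fintype_card, Nat.cast_card_eq_zero]
    rw [hK, Nat.cast_pow] at h0
    exact eq_zero_of_pow_eq_zero h0
  have := congrArg (Int.cast : ℤ → K) (Nat.gcd_eq_gcd_ab g c)
  push_cast at this
  rw [hg, hc, h] at this
  simp at this

theorem mainTheorem9 (p : ℕ) [Fact p.Prime] (hp : p ≠ 2)
    (g : ℕ) (hg : g.Prime) (hgp : orderOf (g : ZMod (p ^ 2)) = Nat.totient (p ^ 2))
    (s t : ℕ) (hst : s * t = p - 1)
    (q u : ℕ) (hq : q = g ^ (p - 1)) (hu : u = g ^ s)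
    (r e : ℕ) (hr : 1 ≤ r)
    (K : Type*) [Field K] [Finite K] (hK : Nat.card K = u ^ p ^ e)
    (L : Type*) [Field L] [Finite L] (hL : Nat.card L = q ^ p ^ e) :
    (1 - (PowerSeries.X : ℚ⟦X⟧) ^ t) * primaryGenFun p r K ^ t =
      (1 - (PowerSeries.X : ℚ⟦X⟧)) ^ t *
        PowerSeries.subst ((PowerSeries.X : ℚ⟦X⟧) ^ t) (primaryGenFun p r L) := by
  have hpp : p.Prime := Fact.out
  have hp1 : 0 < p - 1 := Nat.sub_pos_of_lt hpp.one_lt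
  have hs0 : 0 < s := Nat.pos_of_ne_zero fun h => by simp [h] at hst; omega
  have ht0 : t ≠ 0 := fun h => by simp [h] at hst; omega
  have htp : t.Coprime p := Nat.Coprime.symm <| (Nat.Prime.coprime_iff_not_dvd hpp).2 fun h => by
    have h1 := Nat.le_of_dvd (Nat.pos_of_ne_zero ht0) h
    have h2 := Nat.le_of_dvd hp1 ⟨s, by rw [mul_comm, hst]⟩ (m := t)
    omega
  have hgp_coprime : g.Coprime p := by
    have hunit : IsUnit (g : ZMod (p ^ 2)) := by
      refine (IsOfFinOrder.isUnit (orderOf_pos_iff.1 ?_))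
      rw [hgp]
      exact Nat.totient_pos.2 (pow_pos hpp.pos 2)
    rw [ZMod.isUnit_iff_coprime] at hunit
    exact Nat.Coprime.coprime_dvd_right (dvd_pow_self p two_ne_zero) hunit
  have hK' : Nat.card K = g ^ (s * p ^ e) := by rw [hK, hu, pow_mul]
  have hL' : Nat.card L = g ^ ((p - 1) * p ^ e) := by rw [hL, hq, pow_mul]
  have hLK : Nat.card L = Nat.card K ^ t := by
    rw [hL', hK', ← pow_mul, ← hst]
    congr 1
    ring
  have hcardB : ∀ N, g.Coprime (Nat.card (TruncatedGroup p r N)) := fun N => by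
    rw [natCard_truncatedGroup]
    exact (hgp_coprime.pow_right _).pow_right _
  have hcop : ∀ N n, ¬ t ∣ n →
      (Nat.card (TruncatedGroup p r N)).Coprime (Nat.card K ^ n - 1) := by
    intro N n hn
    rw [natCard_truncatedGroup]
    refine Nat.Coprime.pow_left _ (Nat.Coprime.pow_left _ ?_)
    rw [Nat.Prime.coprime_iff_not_dvd hpp, hK', ← pow_mul]
    refine not_dvd_pow_sub_one_of_orderOf_eq hg.pos hgp fun h => hn ?_
    rw [← hst, mul_assoc] at h
    -- From `s * t ∣ s * (p ^ e * n)`, cancel `s` and then `p ^ e`, which is coprime to `t`.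
    exact (htp.pow_right e).dvd_of_dvd_mul_left (Nat.dvd_of_mul_dvd_mul_left hs0 h)
  ext n
  -- A single truncation level that serves both fields and all coefficients up to `n`; the identity
  -- is then proved modulo `X ^ (n + 1)`.
  let N : ℕ := ∑ k ∈ Finset.range (n + 1),
    (Nat.card (LinearMap.GeneralLinearGroup K (Fin k → K)) +
      Nat.card (LinearMap.GeneralLinearGroup L (Fin k → L)))
  have hN : ∀ k < n + 1, Nat.card (LinearMap.GeneralLinearGroup K (Fin k → K)) +
      Nat.card (LinearMap.GeneralLinearGroup L (Fin k → L)) ≤ N := fun k hk =>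
    Finset.single_le_sum (f := fun k => Nat.card (LinearMap.GeneralLinearGroup K (Fin k → K)) +
      Nat.card (LinearMap.GeneralLinearGroup L (Fin k → L))) (fun _ _ => Nat.zero_le _)
      (Finset.mem_range.2 hk)
  have hBK := natCast_ne_zero_of_natCard_eq_pow hK' (hcardB N)
  have hBL := natCast_ne_zero_of_natCard_eq_pow hL' (hcardB N)
  have hdK : PowerSeries.X ^ (n + 1) ∣
      primaryGenFun p r K - eulerSeries K (TruncatedGroup p r N) := by
    rw [PowerSeries.X_pow_dvd_iff]
    intro k hk
    rw [map_sub, coeff_primaryGenFun hBK k ((Nat.le_add_right _ _).trans (hN k hk)), sub_self]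
  have hdL : PowerSeries.X ^ (n + 1) ∣
      primaryGenFun p r L - eulerSeries L (TruncatedGroup p r N) := by
    rw [PowerSeries.X_pow_dvd_iff]
    intro k hk
    rw [map_sub, coeff_primaryGenFun hBL k ((Nat.le_add_left _ _).trans (hN k hk)), sub_self]
  have hsub : PowerSeries.HasSubst ((PowerSeries.X : ℚ⟦X⟧) ^ t) := PowerSeries.HasSubst.X_pow ht0
  have hdL' : PowerSeries.X ^ (n + 1) ∣
      PowerSeries.subst ((PowerSeries.X : ℚ⟦X⟧) ^ t) (primaryGenFun p r L) -
        PowerSeries.subst ((PowerSeries.X : ℚ⟦X⟧) ^ t)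
          (eulerSeries L (TruncatedGroup p r N)) := by
    have h := map_dvd (PowerSeries.substAlgHom (R := ℚ) hsub) hdL
    rw [map_sub, map_pow, PowerSeries.coe_substAlgHom, PowerSeries.subst_X hsub, ← pow_mul] at h
    -- Substitution turns the modulus into `X ^ (t * (n + 1))`, which is stronger since `t ≥ 1`.
    exact (pow_dvd_pow _ (Nat.le_mul_of_pos_left _ (Nat.pos_of_ne_zero ht0))).trans h
  have hid := eulerSeries_identity ht0 hBK hBL hLK (hcop N)
  have hd := dvd_sub ((hdK.trans (sub_dvd_pow_sub_pow _ _ t)).mul_left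
    (1 - (PowerSeries.X : ℚ⟦X⟧) ^ t)) (hdL'.mul_left ((1 - (PowerSeries.X : ℚ⟦X⟧)) ^ t))
  rw [mul_sub, mul_sub, hid, sub_sub_sub_cancel_right] at hd
  have := PowerSeries.X_pow_dvd_iff.1 hd n (Nat.lt_succ_self n)
  rwa [map_sub, sub_eq_zero] at this
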